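/- Let $\Gamma$ be a finite simple graph with non-empty vertex set $\mathsf V$. Let $G_\Gamma=\langle v\in\mathsf V\mid vw=wv \text{ if } \{v,w\} \text{ is an edge}\rangle$ be its right-angled Artin group, let $\nu\colon G_\Gamma\to\mathbb Z$ be the homomorphism sending every generator $v$ to $1$, and let $N_\Gamma=\ker\nu$ be the Bestvina–Brady group of $\Gamma$. Let $\Delta_\Gamma$ be the flag complex of $\Gamma$, whose $j$-simplices are the $(j+1)$-cliques of $\Gamma$. For a field $k$, the conjugation action of $G_\Gamma$ on $N_\Gamma$ induces an action of $G_\Gamma/N_\Gamma\cong\mathbb Z$ on the homology $H_*(N_\Gamma,k)$ with trivial coefficients, which makes it a module over the group ring $k\mathbb Z$. Then for every integer $r>0$ there is an isomorphism of $k\mathbb Z$-modules $$H_r(N_\Gamma,k)\;\cong\;(k\mathbb Z)^{\dim_k \widetilde H_{r-1}(\Delta_\Gamma,k)}\;\oplus\;({}_\epsilon k)^{\dim_k B_{r-1}(\Delta_\Gamma,k)},$$ where ${}_\epsilon k$ is the trivial $k\mathbb Z$-module $k$, $\widetilde H_{r-1}(\Delta_\Gamma,k)$ is reduced simplicial homology,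 and $B_{r-1}(\Delta_\Gamma,k)$ is the space of simplicial $(r-1)$-boundaries, i.e. the image of the simplicial boundary map from the (oriented) $r$-chains to the $(r-1)$-chains of $\Delta_\Gamma$ over $k$. -/

import Mathlib

universe u

namespace BestvinaBrady

noncomputable section

open CategoryTheory CategoryTheory.Limits

section Groups

variable {V : Type u} (Γ : SimpleGraph V)

/-- The commutators `v * w * v⁻¹ * w⁻¹`, for the edges `{v, w}` of `Γ`, in the free group on the vertices. -/
def commutatorRels : Set (FreeGroup V) :=
  {x | ∃ v w : V, Γ.Adj v w ∧
    x = FreeGroup.of v * FreeGroup.of w * (FreeGroup.of v)⁻¹ * (FreeGroup.of w)⁻¹}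

/-- The right-angled Artin group `⟨v ∈ V | v * w = w * v if {v, w} is an edge⟩`. -/
abbrev ArtinGroup : Type u := PresentedGroup (commutatorRels Γ)

/-- The length homomorphism onto the (multiplicatively written) integers, sending each generator
to `1`. -/
def length : ArtinGroup Γ →* Multiplicative ℤ :=
  PresentedGroup.toGroup (f := fun _ : V => Multiplicative.ofAdd (1 : ℤ)) (by
    rintro _ ⟨v, w, -, rfl⟩
    simp)

lemma length_of (v : V) :
    length Γ (PresentedGroup.of v) = Multiplicative.ofAdd (1 : ℤ) := by
  simp [length]

lemma length_surjective [Nonempty V] : Function.Surjective (length Γ) := fun n =>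
  ⟨PresentedGroup.of (Classical.arbitrary V) ^ n.toAdd, by
    rw [map_zpow, length_of, ← ofAdd_zsmul, smul_eq_mul, mul_one, ofAdd_toAdd]⟩

/-- The Bestvina-Brady group: the kernel of the length homomorphism. -/
abbrev bbGroup : Subgroup (ArtinGroup Γ) := (length Γ).ker

end Groups

section Action

/-- The action `a ↦ g • a` of `g` on `A`, as a morphism over the conjugation `h ↦ g * h * g⁻¹`. -/
def innerHom {k G : Type u} [CommRing k] [Group G] (A : Rep.{u} k G) (g : G) :
    A ⟶ Rep.res (MulAut.conj g).toMonoidHom A :=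
  Rep.ofHom ⟨A.ρ g, fun h => by
    ext x
    simp [← Module.End.mul_apply, ← map_mul]⟩

lemma innerHom_comm {k G : Type u} [CommRing k] [Group G] {A B : Rep.{u} k G} (f : A ⟶ B) (g : G) :
    groupHomology.chainsMap (MulAut.conj g).toMonoidHom (innerHom A g) ≫
        groupHomology.chainsMap (MonoidHom.id G) f =
      groupHomology.chainsMap (MonoidHom.id G) f ≫
        groupHomology.chainsMap (MulAut.conj g).toMonoidHom (innerHom B g) := by
  rw [← groupHomology.chainsMap_comp, ← groupHomology.chainsMap_comp]
  refine groupHomology.chainsMap_congr ?_ ?_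
  · ext; rfl
  · ext x
    exact Rep.hom_comm_apply f g x

/-- Inner automorphisms act trivially on group homology. -/
lemma map_inner {k G : Type u} [CommRing k] [Group G] (g : G) (n : ℕ) : ∀ A : Rep.{u} k G,
    groupHomology.map (MulAut.conj g).toMonoidHom (innerHom A g) n = 𝟙 _ := by
  classical
  induction n with
  | zero =>
    intro A
    rw [← cancel_epi (groupHomology.H0π A), groupHomology.H0π_comp_map, Category.comp_id]
    rw [← cancel_mono (groupHomology.H0Iso A).hom, Category.assoc,
      groupHomology.H0π_comp_H0Iso_hom]
    ext x
    exact Representation.Coinvariants.mk_self_apply A.ρ g x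
  | succ n ih =>
    intro A
    let adj := Rep.indResAdjunction.{u} k (⊥ : Subgroup G).subtype
    let X : ShortComplex (Rep.{u} k G) :=
      ShortComplex.mk (kernel.ι (adj.counit.app A)) (adj.counit.app A) (kernel.condition _)
    have hX : X.ShortExact :=
      { exact := ShortComplex.exact_kernel _
        mono_f := by dsimp [X]; infer_instance
        epi_g := inferInstanceAs (Epi (adj.counit.app A)) }
    have hz : IsZero (groupHomology X.X₂ (n + 1)) :=
      (isZero_groupHomology_succ_of_subsingleton _ n).of_iso
        (groupHomology.indIso (⊥ : Subgroup G) (Rep.res (⊥ : Subgroup G).subtype A) (n + 1))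
    have := groupHomology.mono_δ_of_isZero hX n hz
    let φ : X.map (groupHomology.chainsFunctor k G) ⟶ X.map (groupHomology.chainsFunctor k G) :=
      { τ₁ := groupHomology.chainsMap (MulAut.conj g).toMonoidHom (innerHom X.X₁ g)
        τ₂ := groupHomology.chainsMap (MulAut.conj g).toMonoidHom (innerHom X.X₂ g)
        τ₃ := groupHomology.chainsMap (MulAut.conj g).toMonoidHom (innerHom X.X₃ g)
        comm₁₂ := innerHom_comm X.f g
        comm₂₃ := innerHom_comm X.g g }
    have nat := HomologicalComplex.HomologySequence.δ_naturality φ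
      (groupHomology.map_chainsFunctor_shortExact hX)
      (groupHomology.map_chainsFunctor_shortExact hX) (n + 1) n rfl
    rw [← cancel_mono (groupHomology.δ hX (n + 1) n rfl)]
    have h1 := ih X.X₁
    refine nat.symm.trans ?_
    refine (congrArg (fun f => groupHomology.δ hX (n + 1) n rfl ≫ f) h1).trans ?_
    exact (Category.comp_id _).trans (Category.id_comp _).symm

variable (k : Type u) {G : Type u} [CommRing k] [Group G] (N : Subgroup G) (r : ℕ)

/-- The map induced on `H_r(N, k)`, for trivial coefficients `k`, by an automorphism of `N`. -/
def homologyAut (f : MulAut N) :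
    groupHomology (Rep.trivial k N k) r ⟶ groupHomology (Rep.trivial k N k) r :=
  groupHomology.map (A := Rep.trivial k N k) (B := Rep.trivial k N k) f.toMonoidHom
    (Rep.ofHom ⟨LinearMap.id, fun _ => rfl⟩) r

lemma homologyAut_one : homologyAut k N r 1 = 𝟙 _ := by
  rw [homologyAut, ← groupHomology.map_id]
  exact groupHomology.map_congr rfl rfl r

lemma homologyAut_mul (f g : MulAut N) :
    homologyAut k N r (f * g) = homologyAut k N r g ≫ homologyAut k N r f := by
  simp only [homologyAut]
  rw [← groupHomology.map_comp]
  exact groupHomology.map_congr rfl rfl r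

lemma homologyAut_conj (x : N) : homologyAut k N r (MulAut.conj x) = 𝟙 _ := by
  rw [← map_inner x r (Rep.trivial k N k)]
  exact groupHomology.map_congr rfl rfl r

variable [N.Normal]

/-- The action of `G` on `H_r(N, k)`, for `N` normal in `G`: the element `g` acts by the map
induced by the conjugation `x ↦ g * x * g⁻¹` of `N`. -/
def conjRep : Representation k G (groupHomology (Rep.trivial k N k) r) where
  toFun g := (homologyAut k N r (MulAut.conjNormal g)).hom
  map_one' := by
    rw [map_one, homologyAut_one]
    rfl
  map_mul' g h := by
    rw [map_mul, homologyAut_mul]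
    rfl

lemma conjRep_eq_one {g : G} (hg : g ∈ N) : conjRep k N r g = 1 := by
  have h : (MulAut.conjNormal g : MulAut N) = MulAut.conj ⟨g, hg⟩ := by
    ext x
    simp
  have e : homologyAut k N r (MulAut.conjNormal g) = 𝟙 _ := by rw [h, homologyAut_conj]
  exact congrArg ModuleCat.Hom.hom e

/-- The action of `G ⧸ N` on `H_r(N, k)` induced by conjugation. -/
def quotientRep : Representation k (G ⧸ N) (groupHomology (Rep.trivial k N k) r) :=
  QuotientGroup.lift N (conjRep k N r) fun _ hg => conjRep_eq_one k N r hg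

end Action

section Homology

variable {V : Type u} (Γ : SimpleGraph V) [Nonempty V] (k : Type u) [CommRing k] (r : ℕ)

/-- The action of `ℤ` on `H_r(N, k)`, for `N` the Bestvina-Brady group of `Γ`, given by the
extension `1 → N → ArtinGroup Γ → ℤ → 0`. -/
def homologyRep :
    Representation k (Multiplicative ℤ) (groupHomology (Rep.trivial k (bbGroup Γ) k) r) :=
  (quotientRep k (bbGroup Γ) r).comp
    (QuotientGroup.quotientKerEquivOfSurjective (length Γ) (length_surjective Γ)).symm.toMonoidHom

/-- The integer `n` acts as conjugation by any element of length `n`. -/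
lemma homologyRep_length (g : ArtinGroup Γ) :
    homologyRep Γ k r (length Γ g) = conjRep k (bbGroup Γ) r g := by
  have h : (QuotientGroup.quotientKerEquivOfSurjective (length Γ) (length_surjective Γ)).symm
      (length Γ g) = (g : ArtinGroup Γ ⧸ bbGroup Γ) := by
    rw [MulEquiv.symm_apply_eq]
    rfl
  exact congrArg (quotientRep k (bbGroup Γ) r) h

end Homology

section FlagComplex

variable {V : Type u} [LinearOrder V] (Γ : SimpleGraph V) (k : Type u) [CommRing k]

/-- The oriented simplicial chains of dimension `m - 1` of the flag complex of `Γ`: the free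
module on the simplices with `m` vertices, that is, on the `m`-cliques of `Γ`, each oriented by the
order of the vertices. For `m = 0` the only simplex is the empty one, so that this is the
augmented chain complex. -/
abbrev FlagChains (m : ℕ) : Type u := {s : Finset V // Γ.IsNClique m s} →₀ k

variable {Γ} in
/-- The face of a simplex opposite to one of its vertices. -/
def face {m : ℕ} (s : {s : Finset V // Γ.IsNClique (m + 1) s}) (v : {v // v ∈ s.1}) :
    {s : Finset V // Γ.IsNClique m s} :=
  ⟨s.1.erase v, s.2.isClique.subset (by simp), by
    rw [Finset.card_erase_of_mem v.2, s.2.card_eq, Nat.add_sub_cancel]⟩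

/-- The simplicial boundary `[v₀ < ⋯ < vₘ] ↦ ∑ i, (-1) ^ i • [v₀, …, v̂ᵢ, …, vₘ]`; the exponent `i`
is the number of vertices of the simplex which are smaller than `vᵢ`. For `m = 0` this is the
augmentation. -/
def boundary (m : ℕ) : FlagChains Γ k (m + 1) →ₗ[k] FlagChains Γ k m :=
  Finsupp.linearCombination k fun s =>
    ∑ v ∈ s.1.attach, Finsupp.single (face s v) ((-1 : k) ^ (s.1.filter (· < v.1)).card)

lemma boundary_comp_boundary (m : ℕ) : boundary Γ k m ∘ₗ boundary Γ k (m + 1) = 0 := by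
  have key : ∀ (s : Finset V) (v w : V), v ∈ s → v < w →
      (s.filter (· < w)).card = ((s.erase v).filter (· < w)).card + 1 ∧
        ((s.erase w).filter (· < v)).card = (s.filter (· < v)).card := by
    intro s v w hv hvw
    rw [Finset.filter_erase, Finset.filter_erase, Finset.card_erase_of_mem (by simp [hv, hvw]),
      Finset.erase_eq_of_notMem (s := s.filter (· < v)) (by simp [hvw.le])]
    have : 0 < (s.filter (· < w)).card := Finset.card_pos.2 ⟨v, by simp [hv, hvw]⟩
    omega
  refine Finsupp.lhom_ext fun s a => ?_
  simp only [boundary, LinearMap.comp_apply, Finsupp.linearCombination_single, map_sum,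
    Finset.smul_sum, LinearMap.zero_apply, Finsupp.smul_single, smul_eq_mul]
  rw [Finset.sum_sigma']
  refine Finset.sum_involution
    (fun p _ => ⟨⟨p.2.1, Finset.mem_of_mem_erase p.2.2⟩,
      ⟨p.1.1, Finset.mem_erase.2 ⟨(Finset.ne_of_mem_erase p.2.2).symm, p.1.2⟩⟩⟩) ?_ ?_ ?_ ?_
  · rintro ⟨⟨v, hv⟩, ⟨w, hw⟩⟩ -
    obtain ⟨hwv, hws⟩ := Finset.mem_erase.1 hw
    have hf : face (face s ⟨v, hv⟩) ⟨w, hw⟩ = face (face s ⟨w, hws⟩)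
        ⟨v, Finset.mem_erase.2 ⟨hwv.symm, hv⟩⟩ := Subtype.ext Finset.erase_right_comm
    dsimp only
    rw [hf, ← Finsupp.single_add, Finsupp.single_eq_zero]
    change a * (-1) ^ (s.1.filter (· < v)).card * (-1) ^ ((s.1.erase v).filter (· < w)).card +
      a * (-1) ^ (s.1.filter (· < w)).card * (-1) ^ ((s.1.erase w).filter (· < v)).card = 0
    rcases lt_or_gt_of_ne hwv with h | h
    · rw [(key s.1 w v hws h).1, (key s.1 w v hws h).2]
      ring
    · rw [(key s.1 v w hv h).1, (key s.1 v w hv h).2]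
      ring
  · rintro ⟨⟨v, hv⟩, ⟨w, hw⟩⟩ - - h
    have := congrArg (fun p => p.1.1) h
    exact Finset.ne_of_mem_erase hw this
  · intros
    simp
  · intros
    rfl

/-- The augmented simplicial chain complex of the flag complex, with the simplices with `m` vertices
in degree `m`. -/
def flagComplex : ChainComplex (ModuleCat k) ℕ :=
  ChainComplex.of (fun m => ModuleCat.of k (FlagChains Γ k m))
    (fun m => ModuleCat.ofHom (boundary Γ k m))
    fun m => ModuleCat.hom_ext (boundary_comp_boundary Γ k m)

/-- The reduced simplicial homology of the flag complex in dimension `n`. The simplices of dimension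
`n` are those with `n + 1` vertices. -/
def reducedHomology (n : ℕ) : ModuleCat k := (flagComplex Γ k).homology (n + 1)

/-- The simplicial boundaries of dimension `n` of the flag complex. -/
def boundaries (n : ℕ) : Submodule k (FlagChains Γ k (n + 1)) :=
  LinearMap.range (boundary Γ k (n + 1))

end FlagComplex

end

end BestvinaBrady

/-!
The universal cover of the Salvetti complex of `Γ` is contractible, so its cellular chain complex is
a free resolution of `k` over the group ring of the Artin group `G`: it is free on the cliques of
`Γ`, and the differential sends a clique `s` to `∑ v ∈ s, ± (v - 1) • (s \ {v})`. Passing to the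
coinvariants of the Bestvina-Brady group `N` amounts to replacing each vertex `v` by the generator
`t` of `ℤ`, so `H_r(N, k)` is the homology of `k[ℤ] ⊗ C`, where `C` is the augmented simplicial
chain complex of the flag complex, with the differential `(t - 1) ∂`. As `k[ℤ]` is a domain, the
cycles of this complex are `k[ℤ] ⊗ Z` and its boundaries are `(t - 1) k[ℤ] ⊗ B`, where `Z` and `B`
are the simplicial cycles and boundaries. A complement of `B` in `Z` thus contributes free summands,
and `B` contributes the trivial summands `k[ℤ] / (t - 1) = k`.

* Exactness of the resolution (`exists_totalKoszul_eq`) is proved for a Koszul-type differential over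
  any ring, by induction on a set of vertices `S ∪ {v}`: the cliques containing `v` form a cone over
  the link `L` of `v` in `S`. The induction needs that right multiplication by `v - 1` induces an
  injective map from `k[G / ⟨L⟩]` to `k[G / ⟨S⟩]`, which says that the Bass-Serre graph of the
  HNN-extension with stable letter `v` has no cycles. A left inverse of this map is a Fox derivative
  (`exists_fox`), obtained from the presentation of `G` without normal forms.
* The homology of a normal subgroup `N` with its conjugation action is computed from a projective
  resolution over `G` by dimension shifting (`exists_map_groupHomology`): the connecting maps commute
  with the action of `G`, and the action on the homology in degree `0` is the evident one on
  coinvariants.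
* The splitting of the homology over `k[ℤ]` is `nonempty_equiv_of_splitting`.
-/

set_option linter.unusedSectionVars false

namespace BestvinaBrady

open CategoryTheory CategoryTheory.Limits Finsupp

/-! ### Exactness of Koszul-type complexes on cliques -/

section Koszul

variable {V : Type u} [LinearOrder V] (Γ : SimpleGraph V) {R : Type u} [Ring R]

/-- The Koszul-type differential on the free left `R`-module on all finite sets of vertices, which
sends `s` to `∑ v ∈ s, ± x v • (s \ {v})`. It is defined on all finite sets, rather than on cliques
of a given size, to keep dependent types out of the proof of exactness; its square vanishes only on
cliques. -/
noncomputable def totalKoszul (x : V → R) : (Finset V →₀ R) →ₗ[R] (Finset V →₀ R) :=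
  linearCombination R fun s => ∑ v ∈ s, single (s.erase v) ((-1) ^ (s.filter (· < v)).card * x v)

/-- The submodule spanned by the cliques with `n` vertices, all of them in `S`. -/
def cliqueChains (R : Type u) [Ring R] (S : Finset V) (n : ℕ) : Submodule R (Finset V →₀ R) :=
  supported R R {s | s ⊆ S ∧ Γ.IsNClique n s}

/-- The left ideal of `R` generated by the `x w`, for `w ∈ S`. For `x w = w - 1` in a group ring, its
quotient is the permutation module on the cosets of the subgroup generated by `S`. -/
def genIdeal (x : V → R) (S : Finset V) : Submodule R R := Submodule.span R (x '' S)

/-- The cone with apex `v`, which adds the vertex `v` to each simplex. It is meaningful on the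
simplices which do not contain `v`. -/
noncomputable def cone (R : Type u) [Ring R] (v : V) : (Finset V →₀ R) →ₗ[R] (Finset V →₀ R) :=
  lmapDomain R R (insert v)

/-- Multiplication of the coefficients by `a` on the right. -/
noncomputable def rightMul (a : R) : (Finset V →₀ R) →ₗ[R] (Finset V →₀ R) :=
  mapRange.linearMap (LinearMap.mulRight R a)

variable {Γ} (x : V → R)

lemma totalKoszul_single (s : Finset V) (a : R) :
    totalKoszul x (single s a) =
      ∑ v ∈ s, single (s.erase v) ((-1) ^ (s.filter (· < v)).card * (a * x v)) := by
  simp only [totalKoszul, linearCombination_single, Finset.smul_sum, smul_single, smul_eq_mul]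
  refine Finset.sum_congr rfl fun v _ => ?_
  rw [← mul_assoc, ← mul_assoc, ((Commute.neg_one_right a).pow_right _).eq]

lemma cone_single (v : V) (s : Finset V) (a : R) : cone R v (single s a) = single (insert v s) a := by
  simp [cone]

lemma rightMul_single (b : R) (s : Finset V) (a : R) :
    rightMul b (single s a) = single s (a * b) := by
  simp [rightMul]

lemma cliqueChains_eq_span (S : Finset V) (n : ℕ) :
    cliqueChains Γ R S n = Submodule.span R ((fun s => single s 1) '' {s | s ⊆ S ∧ Γ.IsNClique n s}) :=
  supported_eq_span_single _ _

lemma single_mem_cliqueChains {S s : Finset V} {n : ℕ} (hs : s ⊆ S) (hn : Γ.IsNClique n s) (a : R) :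
    single s a ∈ cliqueChains Γ R S n :=
  single_mem_supported _ _ ⟨hs, hn⟩

lemma cliqueChains_mono {S T : Finset V} (h : S ⊆ T) (n : ℕ) :
    cliqueChains Γ R S n ≤ cliqueChains Γ R T n :=
  supported_mono fun _ hs => ⟨hs.1.trans h, hs.2⟩

lemma cliqueChains_eqOn {M : Type*} [AddCommGroup M] [Module R M] {S : Finset V} {n : ℕ}
    {f g : (Finset V →₀ R) →ₗ[R] M}
    (h : ∀ s ⊆ S, Γ.IsNClique n s → f (single s 1) = g (single s 1)) {y : Finset V →₀ R}
    (hy : y ∈ cliqueChains Γ R S n) : f y = g y := by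
  rw [cliqueChains_eq_span] at hy
  refine LinearMap.eqOn_span ?_ hy
  rintro _ ⟨s, hs, rfl⟩
  exact h s hs.1 hs.2

lemma cliqueChains_le_comap {M : Type*} [AddCommGroup M] [Module R M] {S : Finset V} {n : ℕ}
    {f : (Finset V →₀ R) →ₗ[R] M} {N : Submodule R M}
    (h : ∀ s ⊆ S, Γ.IsNClique n s → f (single s 1) ∈ N) {y : Finset V →₀ R}
    (hy : y ∈ cliqueChains Γ R S n) : f y ∈ N := by
  rw [cliqueChains_eq_span] at hy
  change y ∈ N.comap f
  refine (Submodule.span_le.2 ?_) hy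
  rintro _ ⟨s, hs, rfl⟩
  exact h s hs.1 hs.2

lemma isNClique_erase {s : Finset V} {n : ℕ} (hs : Γ.IsNClique (n + 1) s) {v : V} (hv : v ∈ s) :
    Γ.IsNClique n (s.erase v) :=
  ⟨hs.isClique.subset (by simp), by rw [Finset.card_erase_of_mem hv, hs.card_eq]; rfl⟩

lemma totalKoszul_mem {S : Finset V} {n : ℕ} {y : Finset V →₀ R}
    (hy : y ∈ cliqueChains Γ R S (n + 1)) : totalKoszul x y ∈ cliqueChains Γ R S n := by
  refine cliqueChains_le_comap (fun s hs hn => ?_) hy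
  rw [totalKoszul_single]
  exact Submodule.sum_mem _ fun v hv =>
    single_mem_cliqueChains ((Finset.erase_subset _ _).trans hs) (isNClique_erase hn hv) _

lemma totalKoszul_eq_zero {S : Finset V} {y : Finset V →₀ R}
    (hy : y ∈ cliqueChains Γ R S 0) : totalKoszul x y = 0 := by
  refine cliqueChains_eqOn (g := 0) (fun s _ hn => ?_) hy
  rw [Finset.card_eq_zero.1 hn.card_eq, totalKoszul_single]
  simp

variable {v : V} {S : Finset V}

/-- The simplices of the link of `v` are those to which `v` can be added. -/
lemma isNClique_insert_iff [DecidableRel Γ.Adj] {s : Finset V} {n : ℕ} (hvS : v ∉ S) :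
    insert v s ⊆ insert v S ∧ v ∉ s ∧ Γ.IsNClique (n + 1) (insert v s) ↔
      s ⊆ S.filter (Γ.Adj v) ∧ Γ.IsNClique n s := by
  constructor
  · rintro ⟨h1, hv, h2⟩
    have h3 := SimpleGraph.isClique_insert.1 (Finset.coe_insert v s ▸ h2.isClique)
    refine ⟨fun w hw => ?_, h3.1, by
      have := h2.card_eq; rw [Finset.card_insert_of_notMem hv] at this; omega⟩
    have hwv : v ≠ w := fun h => hv (h ▸ hw)
    exact Finset.mem_filter.2 ⟨((Finset.mem_insert.1 (h1 (Finset.mem_insert_of_mem hw))).resolve_left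
      hwv.symm), h3.2 w hw hwv⟩
  · rintro ⟨h1, h2⟩
    have hv : v ∉ s := fun h => hvS (Finset.mem_filter.1 (h1 h)).1
    exact ⟨Finset.insert_subset_insert _ (h1.trans (Finset.filter_subset _ _)), hv,
      h2.insert fun w hw => (Finset.mem_filter.1 (h1 hw)).2⟩

variable [DecidableRel Γ.Adj]

lemma cone_mem (hvS : v ∉ S) {n : ℕ} {y : Finset V →₀ R}
    (hy : y ∈ cliqueChains Γ R (S.filter (Γ.Adj v)) n) :
    cone R v y ∈ cliqueChains Γ R (insert v S) (n + 1) := by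
  refine cliqueChains_le_comap (fun s hs hn => ?_) hy
  rw [cone_single]
  have := (isNClique_insert_iff hvS).2 ⟨hs, hn⟩
  exact single_mem_cliqueChains this.1 this.2.2 _

lemma rightMul_mem {n : ℕ} (a : R) {y : Finset V →₀ R}
    (hy : y ∈ cliqueChains Γ R (S.filter (Γ.Adj v)) n) :
    rightMul a y ∈ cliqueChains Γ R S n := by
  refine cliqueChains_le_comap (fun s hs hn => ?_) hy
  rw [rightMul_single]
  exact single_mem_cliqueChains (hs.trans (Finset.filter_subset _ _)) hn _

/-- Every chain splits into a part avoiding `v` and a part containing `v`. -/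
lemma exists_add_cone (hvS : v ∉ S) {n : ℕ} {y : Finset V →₀ R}
    (hy : y ∈ cliqueChains Γ R (insert v S) (n + 1)) :
    ∃ y' ∈ cliqueChains Γ R S (n + 1), ∃ y'' ∈ cliqueChains Γ R (S.filter (Γ.Adj v)) n,
      y = y' + cone R v y'' := by
  have : y ∈ cliqueChains Γ R S (n + 1) ⊔
      (cliqueChains Γ R (S.filter (Γ.Adj v)) n).map (cone R v) := by
    refine cliqueChains_le_comap (f := LinearMap.id) (fun s hs hn => ?_) hy
    by_cases hv : v ∈ s
    · refine Submodule.mem_sup_right ⟨single (s.erase v) 1, ?_, ?_⟩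
      · have := (isNClique_insert_iff (s := s.erase v) (n := n) hvS).1
          ⟨by rwa [Finset.insert_erase hv], by simp, by rwa [Finset.insert_erase hv]⟩
        exact single_mem_cliqueChains this.1 this.2 _
      · rw [cone_single, Finset.insert_erase hv, LinearMap.id_apply]
    · exact Submodule.mem_sup_left
        (single_mem_cliqueChains ((Finset.subset_insert_iff_of_notMem hv).1 hs) hn _)
  obtain ⟨y', hy', _, ⟨y'', hy'', rfl⟩, rfl⟩ := Submodule.mem_sup.1 this
  exact ⟨y', hy', y'', hy'', rfl⟩

lemma add_cone_eq_zero {y z : Finset V →₀ R} (hy : ∀ s ∈ y.support, v ∉ s)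
    (hz : ∀ s ∈ z.support, v ∉ s) (h : y + cone R v z = 0) : y = 0 ∧ z = 0 := by
  have hc : ∀ s, v ∉ s → cone R v z s = 0 := fun s hs => by
    by_contra hne
    have := mapDomain_support (mem_support_iff.2 hne)
    obtain ⟨t, -, rfl⟩ := Finset.mem_image.1 this
    exact hs (Finset.mem_insert_self _ _)
  have hy0 : y = 0 := by
    ext s
    by_cases hs : v ∈ s
    · by_contra hne
      exact hy s (mem_support_iff.2 hne) hs
    · simpa [hc s hs] using DFunLike.congr_fun h s
  refine ⟨hy0, ?_⟩
  rw [hy0, zero_add] at h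
  refine mapDomain_injOn {s : Finset V | v ∉ s} (f := insert v) ?_ hz (by simp) (h.trans (map_zero (cone R v)).symm)
  intro s hs t ht hst
  rw [← Finset.erase_insert hs, ← Finset.erase_insert ht, hst]

lemma notMem_of_mem_support {n : ℕ} (hvS : v ∉ S) {y : Finset V →₀ R}
    (hy : y ∈ cliqueChains Γ R S n) : ∀ s ∈ y.support, v ∉ s := fun _ hs hv =>
  hvS ((mem_supported R y).1 hy hs |>.1 hv)

/-- If `v` is larger than the other vertices, then the differential of a cone is the cone of the
differential, up to multiplication by `x v` on the base. -/
lemma totalKoszul_cone (hvS : ∀ w ∈ S, w < v) {n : ℕ} {y : Finset V →₀ R}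
    (hy : y ∈ cliqueChains Γ R S n) :
    totalKoszul x (cone R v y) = cone R v (totalKoszul x y) + (-1 : ℤ) ^ n • rightMul (x v) y := by
  refine cliqueChains_eqOn (f := totalKoszul x ∘ₗ cone R v)
    (g := cone R v ∘ₗ totalKoszul x + (-1 : ℤ) ^ n • rightMul (x v)) (fun s hs hn => ?_) hy
  have hv : v ∉ s := fun h => lt_irrefl _ (hvS v (hs h))
  simp only [LinearMap.comp_apply, LinearMap.add_apply, LinearMap.smul_apply, cone_single,
    totalKoszul_single, rightMul_single, map_sum]
  rw [Finset.sum_insert hv, add_comm, Finset.erase_insert hv, Finset.filter_insert,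
    if_neg (lt_irrefl v), Finset.filter_true_of_mem fun w hw => hvS w (hs hw), hn.card_eq]
  congr 1
  · refine Finset.sum_congr rfl fun w hw => ?_
    rw [Finset.filter_insert, if_neg (hvS w (hs hw)).not_gt, Finset.erase_insert_of_ne]
    exact (hvS w (hs hw)).ne'
  · rw [smul_single]
    congr 1
    rw [one_mul, zsmul_eq_mul, Int.cast_pow, Int.cast_neg, Int.cast_one]

lemma totalKoszul_rightMul (hx : ∀ v w, Γ.Adj v w → x v * x w = x w * x v) {n : ℕ}
    {y : Finset V →₀ R} (hy : y ∈ cliqueChains Γ R (S.filter (Γ.Adj v)) n) :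
    totalKoszul x (rightMul (x v) y) = rightMul (x v) (totalKoszul x y) := by
  refine cliqueChains_eqOn (f := totalKoszul x ∘ₗ rightMul (x v))
    (g := rightMul (x v) ∘ₗ totalKoszul x) (fun s hs _ => ?_) hy
  simp only [LinearMap.comp_apply, rightMul_single, totalKoszul_single, map_sum]
  refine Finset.sum_congr rfl fun w hw => ?_
  rw [one_mul, one_mul, mul_assoc, hx v w (Finset.mem_filter.1 (hs hw)).2]

/-- The differential maps the chains on single vertices onto the left ideal generated by `x`. -/
lemma map_totalKoszul_one :
    (cliqueChains Γ R S 1).map (totalKoszul x) = (genIdeal x S).map (lsingle ∅) := by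
  rw [cliqueChains_eq_span, genIdeal, Submodule.map_span, Submodule.map_span, ← Set.image_comp,
    ← Set.image_comp]
  congr 1
  ext y
  simp only [Set.mem_image, Set.mem_ofPred_eq, Function.comp_apply, SimpleGraph.isNClique_one]
  constructor
  · rintro ⟨_, ⟨hw, w, rfl⟩, rfl⟩
    exact ⟨w, hw (Finset.mem_singleton_self w), by simp [totalKoszul_single, Finset.filter_singleton, -single_mul]⟩
  · rintro ⟨w, hw, rfl⟩
    exact ⟨{w}, ⟨by simpa using hw, w, rfl⟩, by simp [totalKoszul_single, Finset.filter_singleton, -single_mul]⟩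

/-- The differential squares to zero on cliques. Adding the largest vertex `v` last, both terms of the
differential of a cone reproduce `x v` times the differential of the base, with opposite signs. -/
lemma totalKoszul_totalKoszul (hx : ∀ v w, Γ.Adj v w → x v * x w = x w * x v) (S : Finset V) :
    ∀ (n : ℕ) (y : Finset V →₀ R), y ∈ cliqueChains Γ R S n → totalKoszul x (totalKoszul x y) = 0 := by
  induction S using Finset.induction_on_max with
  | empty =>
    rintro (_ | n) y hy
    · rw [totalKoszul_eq_zero x hy, map_zero]
    · refine cliqueChains_eqOn (f := totalKoszul x ∘ₗ totalKoszul x) (g := 0)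
        (fun s hs hn => ?_) hy
      have := hn.card_eq
      rw [Finset.subset_empty.1 hs] at this
      simp at this
  | insert v S hv ih =>
    have hvS : v ∉ S := fun h => lt_irrefl _ (hv v h)
    rintro (_ | n) y hy
    · rw [totalKoszul_eq_zero x hy, map_zero]
    · obtain ⟨y', hy', y'', hy'', rfl⟩ := exists_add_cone hvS hy
      have hL := cliqueChains_mono (R := R) (Γ := Γ) (S.filter_subset (Γ.Adj v))
      rw [map_add, map_add, ih _ _ hy', zero_add, totalKoszul_cone x hv (hL _ hy''), map_add,
        map_zsmul, totalKoszul_rightMul x hx hy'']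
      rcases n with _ | n
      · simp [totalKoszul_eq_zero x hy'']
      · rw [totalKoszul_cone x hv (hL _ (totalKoszul_mem x hy'')), ih _ _ (hL _ hy''), map_zero,
          zero_add, pow_succ]
        simp

/-- Exactness of the Koszul-type complex in positive degrees. The hypothesis `hreg` says that right
multiplication by `x v` induces an injective map from the quotient of `R` by the ideal of the link of
`v` in `S` to the quotient of `R` by the ideal of `S`. It is used only for chains of degree one, the
component in higher degrees being handled by induction. -/
lemma exists_totalKoszul_eq (hx : ∀ v w, Γ.Adj v w → x v * x w = x w * x v)
    (hreg : ∀ (S : Finset V) (v : V), (∀ w ∈ S, w < v) → ∀ a, a * x v ∈ genIdeal x S →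
      a ∈ genIdeal x (S.filter (Γ.Adj v))) (S : Finset V) :
    ∀ (n : ℕ) (y : Finset V →₀ R), y ∈ cliqueChains Γ R S (n + 1) → totalKoszul x y = 0 →
      ∃ z ∈ cliqueChains Γ R S (n + 2), totalKoszul x z = y := by
  induction S using Finset.strongInduction with
  | H T ih =>
  intro n y hy hdy
  rcases T.eq_empty_or_nonempty with rfl | hT
  · refine ⟨0, zero_mem _, ?_⟩
    rw [map_zero]
    refine (cliqueChains_eqOn (f := LinearMap.id) (g := 0) (fun s hs hn => ?_) hy).symm
    have := hn.card_eq
    rw [Finset.subset_empty.1 hs] at this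
    simp at this
  obtain ⟨v, S, hv, rfl⟩ : ∃ v S, (∀ w ∈ S, w < v) ∧ insert v S = T :=
    ⟨T.max' hT, T.erase (T.max' hT), fun w hw => T.lt_max'_of_mem_erase_max' hT hw,
      Finset.insert_erase (T.max'_mem hT)⟩
  have hvS : v ∉ S := fun h => lt_irrefl _ (hv v h)
  have hL := cliqueChains_mono (R := R) (Γ := Γ) (S.filter_subset (Γ.Adj v))
  have hvL : v ∉ S.filter (Γ.Adj v) := fun h => hvS (Finset.mem_of_mem_filter _ h)
  obtain ⟨y', hy', y'', hy'', rfl⟩ := exists_add_cone hvS hy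
  -- `h1` and `h2` are the components of `d y = 0` away from `v` and at `v`.
  rw [map_add, totalKoszul_cone x hv (hL _ hy''), add_comm (cone R v _), ← add_assoc] at hdy
  obtain ⟨h1, h2⟩ := add_cone_eq_zero
    (notMem_of_mem_support hvS (add_mem (totalKoszul_mem x hy')
      (Submodule.smul_of_tower_mem _ _ (rightMul_mem _ hy''))))
    (by
      rcases n with _ | n
      · simp [totalKoszul_eq_zero x hy'']
      · exact notMem_of_mem_support hvL (totalKoszul_mem x hy'')) hdy
  -- The component at `v` is a cycle of the link, and it bounds there.
  obtain ⟨z'', hz'', rfl⟩ : ∃ z'' ∈ cliqueChains Γ R (S.filter (Γ.Adj v)) (n + 1),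
      totalKoszul x z'' = y'' := by
    rcases n with _ | n
    · obtain ⟨a, rfl⟩ : ∃ a, y'' = single ∅ a := by
        refine ⟨y'' ∅, Finsupp.ext fun s => ?_⟩
        rcases eq_or_ne s ∅ with rfl | hs
        · simp
        · rw [single_eq_of_ne hs]
          by_contra hne
          exact hs (Finset.card_eq_zero.1
            ((mem_supported R y'').1 hy'' (mem_support_iff.2 hne)).2.card_eq)
      have ha : a * x v ∈ genIdeal x S := by
        have : single ∅ (a * x v) ∈ (cliqueChains Γ R S 1).map (totalKoszul x) := by
          refine ⟨-y', neg_mem hy', ?_⟩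
          rw [pow_zero, one_smul, rightMul_single] at h1
          rw [map_neg, neg_eq_iff_add_eq_zero, h1]
        rw [map_totalKoszul_one] at this
        obtain ⟨b, hb, hba⟩ := this
        rwa [single_injective _ hba] at hb
      have : single ∅ a ∈ (cliqueChains Γ R (S.filter (Γ.Adj v)) 1).map (totalKoszul x) := by
        rw [map_totalKoszul_one]
        exact ⟨a, hreg S v hv a ha, rfl⟩
      exact this
    · exact ih _ ((Finset.filter_subset _ _).trans_ssubset (Finset.ssubset_insert hvS)) n y''
        hy'' h2
  -- Subtracting the differential of the cone over `z''` leaves a cycle which avoids `v`.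
  obtain ⟨z', hz', hz⟩ := ih S (Finset.ssubset_insert hvS) n
    (y' - (-1 : ℤ) ^ (n + 1) • rightMul (x v) z'')
    (sub_mem hy' (Submodule.smul_of_tower_mem _ _ (rightMul_mem _ hz''))) (by
      rw [map_sub, map_zsmul, totalKoszul_rightMul x hx hz'', ← h1, pow_succ]
      simp)
  refine ⟨z' + cone R v z'', add_mem (cliqueChains_mono (Finset.subset_insert _ _) _ hz')
    (cone_mem hvS hz''), ?_⟩
  rw [map_add, hz, totalKoszul_cone x hv (hL _ hz'')]
  abel

end Koszul

/-! ### The Fox derivative on a right-angled Artin group -/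

section Fox

variable {V : Type u} (Γ : SimpleGraph V) (k : Type u) [CommRing k]

/-- The element `v - 1` of the group ring of the Artin group. -/
noncomputable def vertexSubOne (v : V) : MonoidAlgebra k (ArtinGroup Γ) :=
  MonoidAlgebra.of k _ (PresentedGroup.of v) - 1

lemma of_mul_of_comm {v w : V} (h : Γ.Adj v w) :
    (PresentedGroup.of v : ArtinGroup Γ) * PresentedGroup.of w =
      PresentedGroup.of w * PresentedGroup.of v := by
  have : (PresentedGroup.mk (commutatorRels Γ)
      (FreeGroup.of v * FreeGroup.of w * (FreeGroup.of v)⁻¹ * (FreeGroup.of w)⁻¹)) = 1 :=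
    PresentedGroup.one_of_mem ⟨v, w, h, rfl⟩
  simp only [map_mul, map_inv] at this
  exact mul_inv_eq_iff_eq_mul.1 (mul_inv_eq_one.1 this)

lemma vertexSubOne_comm (v w : V) (h : Γ.Adj v w) :
    vertexSubOne Γ k v * vertexSubOne Γ k w = vertexSubOne Γ k w * vertexSubOne Γ k v := by
  have : MonoidAlgebra.of k _ (PresentedGroup.of v : ArtinGroup Γ) *
      MonoidAlgebra.of k _ (PresentedGroup.of w) =
      MonoidAlgebra.of k _ (PresentedGroup.of w) * MonoidAlgebra.of k _ (PresentedGroup.of v) := by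
    rw [← map_mul, ← map_mul, of_mul_of_comm Γ h]
  simp only [vertexSubOne, sub_mul, mul_sub, this, one_mul, mul_one]
  abel

variable [DecidableEq V] [DecidableRel Γ.Adj]

/-- The retraction of the Artin group onto the subgroup generated by `S`, which sends the other
vertices to `1`. -/
def retract (S : Finset V) : ArtinGroup Γ →* ArtinGroup Γ :=
  PresentedGroup.toGroup (f := fun w => if w ∈ S then PresentedGroup.of w else 1) (by
    rintro _ ⟨v, w, h, rfl⟩
    by_cases hv : v ∈ S <;> by_cases hw : w ∈ S <;> simp [hv, hw, of_mul_of_comm Γ h])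

lemma retract_of (S : Finset V) (w : V) :
    retract Γ S (PresentedGroup.of w) = if w ∈ S then PresentedGroup.of w else 1 := by
  simp [retract]

/-- One step of the walk computing a Fox derivative: the position is multiplied by `g`, and the value
of `c` at the old position is added to the accumulated sum. -/
def foxStep {G Q : Type*} [Group G] [AddCommGroup Q] (g : G) (c : G → Q) : Equiv.Perm (G × Q) where
  toFun p := (p.1 * g, p.2 + c p.1)
  invFun p := (p.1 * g⁻¹, p.2 - c (p.1 * g⁻¹))
  left_inv p := by simp
  right_inv p := by simp

/-- The Fox derivative with respect to `v`: a function `F` on the Artin group which does not change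
along the edges labelled by vertices of `S`, and which changes by `c` along the edges labelled by `v`.
It exists if `c` is invariant under the vertices of the link of `v` in `S`.

The generators in `S ∪ {v}` act on pairs (position, accumulated sum) by `foxStep`, and the other
generators act trivially. These permutations satisfy the relations of the Artin group, and `F g` is
the sum accumulated by the walk along `g` that ends at `g`. -/
lemma exists_fox {Q : Type*} [AddCommGroup Q] (c : ArtinGroup Γ → Q) (S : Finset V) (v : V)
    (hv : v ∉ S) (hc : ∀ g, ∀ w ∈ S, Γ.Adj v w → c (g * PresentedGroup.of w) = c g) :
    ∃ F : ArtinGroup Γ → Q, (∀ g, ∀ w ∈ S, F (g * PresentedGroup.of w) = F g) ∧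
      ∀ g, F (g * PresentedGroup.of v) = F g + c g := by
  -- The walk multiplies positions on the right, whence the opposite group.
  let f : V → (Equiv.Perm (ArtinGroup Γ × Q))ᵐᵒᵖ := fun w => MulOpposite.op
    (if w ∈ insert v S then foxStep (PresentedGroup.of w) (if w = v then c else 0) else 1)
  have hf : ∀ r ∈ commutatorRels Γ, FreeGroup.lift f r = 1 := by
    rintro _ ⟨a, b, h, rfl⟩
    simp only [map_mul, map_inv, FreeGroup.lift_apply_of]
    rw [mul_inv_eq_one, mul_inv_eq_iff_eq_mul, ← MulOpposite.unop_inj, MulOpposite.unop_mul,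
      MulOpposite.unop_mul]
    ext1 p
    simp only [f, MulOpposite.unop_op, Equiv.Perm.mul_apply]
    by_cases ha : a ∈ insert v S
    swap
    · simp [ha]
    by_cases hb : b ∈ insert v S
    swap
    · simp [hb]
    rw [if_pos ha, if_pos hb]
    have hab := h.ne
    rw [Finset.mem_insert] at ha hb
    refine Prod.ext ?_ ?_
    · simp [foxStep, mul_assoc, of_mul_of_comm Γ h]
    · by_cases hav : a = v
      · subst hav
        simp [foxStep, hab.symm, hc p.1 b (hb.resolve_left hab.symm) h]
      · by_cases hbv : b = v
        · subst hbv
          simp [foxStep, hab, hc p.1 a (ha.resolve_left hab) h.symm]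
        · simp [foxStep, hav, hbv]
  let θ := PresentedGroup.toGroup hf
  have hθ : ∀ w, θ (PresentedGroup.of w) = f w := fun w => PresentedGroup.toGroup.of hf
  let ρ := retract Γ (insert v S)
  have hρ : ∀ w ∈ insert v S, ρ (PresentedGroup.of w) = PresentedGroup.of w := fun w hw => by
    rw [retract_of, if_pos hw]
  have hρ' : ∀ w ∉ insert v S, ρ (PresentedGroup.of w) = 1 := fun w hw => by
    rw [retract_of, if_neg hw]
  -- The walk along `g` moves the position by the retraction `ρ g`, so it has to start at
  -- `g * (ρ g)⁻¹` in order to end at `g`; this starting point does not change if `g` is multiplied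
  -- by a generator in `S ∪ {v}`.
  have h1 : ∀ g p, ((θ g).unop p).1 = p.1 * ρ g := by
    intro g
    induction g using PresentedGroup.induction_on with
    | _ z =>
    induction z using FreeGroup.induction_on with
    | C1 => simp
    | of w =>
      intro p
      change ((θ (PresentedGroup.of w)).unop p).1 = p.1 * ρ (PresentedGroup.of w)
      rw [hθ]
      by_cases hw : w ∈ insert v S
      · rw [hρ w hw]
        simp only [f, MulOpposite.unop_op, if_pos hw]
        rfl
      · rw [hρ' w hw]
        simp [f, if_neg hw, -Finset.mem_insert]
    | inv_of w ih =>
      intro p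
      have := ih ((θ (PresentedGroup.mk _ (FreeGroup.of w)))⁻¹.unop p)
      rw [map_inv, map_inv, map_inv, this.symm.trans ?_ |> eq_mul_inv_iff_mul_eq.2]
      simp
    | mul x y hx hy =>
      intro p
      rw [map_mul, map_mul, map_mul, MulOpposite.unop_mul, Equiv.Perm.mul_apply, hy, hx, mul_assoc]
  have h2 : ∀ w ∈ insert v S, ∀ g : ArtinGroup Γ,
      ((θ (g * PresentedGroup.of w)).unop
          (g * PresentedGroup.of w * (ρ (g * PresentedGroup.of w))⁻¹, 0)).2 =
        ((θ g).unop (g * (ρ g)⁻¹, 0)).2 + (if w = v then c else 0) g := by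
    intro w hw g
    have : g * PresentedGroup.of w * (ρ (g * PresentedGroup.of w))⁻¹ = g * (ρ g)⁻¹ := by
      rw [map_mul, hρ w hw]
      group
    rw [this, map_mul, MulOpposite.unop_mul, Equiv.Perm.mul_apply, hθ]
    simp only [f, MulOpposite.unop_op, if_pos hw]
    change _ + (if w = v then c else 0) ((θ g).unop (g * (ρ g)⁻¹, 0)).1 = _
    rw [h1]
    simp
  refine ⟨fun g => ((θ g).unop (g * (ρ g)⁻¹, 0)).2, fun g w hw => ?_, fun g => ?_⟩
  · refine (h2 w (Finset.mem_insert_of_mem hw) g).trans ?_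
    have hwv : w ≠ v := fun h => hv (h ▸ hw)
    rw [if_neg hwv]
    simp
  · refine (h2 v (Finset.mem_insert_self _ _) g).trans ?_
    rw [if_pos rfl]

/-- Right multiplication by `v - 1` induces an injective map from the permutation module on the cosets
of the subgroup generated by the link of `v` in `S` to the one for the subgroup generated by `S`. -/
lemma mem_genIdeal_of_mul_mem (S : Finset V) (v : V) (hv : v ∉ S)
    (a : MonoidAlgebra k (ArtinGroup Γ))
    (ha : a * vertexSubOne Γ k v ∈ genIdeal (vertexSubOne Γ k) S) :
    a ∈ genIdeal (vertexSubOne Γ k) (S.filter (Γ.Adj v)) := by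
  let J := genIdeal (vertexSubOne Γ k) (S.filter (Γ.Adj v))
  let q : MonoidAlgebra k (ArtinGroup Γ) →ₗ[k] (MonoidAlgebra k (ArtinGroup Γ) ⧸ J) :=
    J.mkQ.restrictScalars k
  obtain ⟨F, hF1, hF2⟩ := exists_fox Γ (fun g => q (MonoidAlgebra.of k _ g)) S v hv (by
    intro g w hw h
    rw [← sub_eq_zero, ← map_sub, map_mul]
    refine (Submodule.Quotient.mk_eq_zero J).2 ?_
    have : vertexSubOne Γ k w ∈ J :=
      Submodule.subset_span ⟨w, by simpa using ⟨hw, h⟩, rfl⟩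
    simpa [vertexSubOne, mul_sub] using J.smul_mem (MonoidAlgebra.of k _ g) this)
  let Φ : MonoidAlgebra k (ArtinGroup Γ) →ₗ[k] (MonoidAlgebra k (ArtinGroup Γ) ⧸ J) :=
    Finsupp.lift _ k _ F ∘ₗ (MonoidAlgebra.coeffLinearEquiv k).toLinearMap
  have hΦ : ∀ g, Φ (MonoidAlgebra.of k _ g) = F g := fun g => by
    simp [Φ]
  -- `Φ` vanishes on the left ideal of `S`, and inverts right multiplication by `v - 1`.
  have hS : ∀ w ∈ S, ∀ b, Φ (b * vertexSubOne Γ k w) = 0 := by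
    intro w hw b
    induction b using MonoidAlgebra.induction_on with
    | of g => rw [vertexSubOne, mul_sub, ← map_mul, mul_one, map_sub, hΦ, hΦ, hF1 g w hw, sub_self]
    | add b c hb hc => rw [add_mul, map_add, hb, hc, add_zero]
    | smul r b hb => rw [smul_mul_assoc, map_smul, hb, smul_zero]
  have hV : ∀ b, Φ (b * vertexSubOne Γ k v) = q b := by
    intro b
    induction b using MonoidAlgebra.induction_on with
    | of g => rw [vertexSubOne, mul_sub, ← map_mul, mul_one, map_sub, hΦ, hΦ, hF2 g,
        add_sub_cancel_left]
    | add b c hb hc => rw [add_mul, map_add, hb, hc, map_add]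
    | smul r b hb => rw [smul_mul_assoc, map_smul, hb, map_smul]
  have hJ : ∀ y ∈ genIdeal (vertexSubOne Γ k) S, ∀ b, Φ (b * y) = 0 := by
    intro y hy
    induction hy using Submodule.span_induction with
    | mem y hy =>
      obtain ⟨w, hw, rfl⟩ := hy
      exact hS w hw
    | zero => simp
    | add y z _ _ hy hz => intro b; rw [mul_add, map_add, hy, hz, add_zero]
    | smul c y _ hy => intro b; rw [smul_eq_mul, ← mul_assoc, hy]
  refine (Submodule.Quotient.mk_eq_zero J).1 ?_
  have := hJ _ ha 1
  rw [one_mul, hV] at this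
  exact this

end Fox

/-! ### Homology of a normal subgroup by dimension shifting -/

section Shift

variable {k G : Type u} [CommRing k] [Group G]

/-- Projective representations are acyclic for group homology: they are direct summands of
representations induced from the trivial subgroup, which are acyclic by Shapiro's lemma. -/
lemma isZero_groupHomology_of_projective (A : Rep.{u} k G) [Projective A] (n : ℕ) :
    IsZero (groupHomology A (n + 1)) := by
  classical
  let adj := Rep.indResAdjunction.{u} k (⊥ : Subgroup G).subtype
  have hz : IsZero (groupHomology (Rep.ind (⊥ : Subgroup G).subtype
      (Rep.res (⊥ : Subgroup G).subtype A)) (n + 1)) :=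
    (isZero_groupHomology_succ_of_subsingleton _ n).of_iso
      (groupHomology.indIso (⊥ : Subgroup G) (Rep.res (⊥ : Subgroup G).subtype A) (n + 1))
  have : Epi (adj.counit.app A) := inferInstance
  have h := Projective.factorThru_comp (𝟙 A) (adj.counit.app A)
  rw [IsZero.iff_id_eq_zero]
  have h' := congrArg (fun f => (groupHomology.functor k G (n + 1)).map f) h
  simp only [Functor.map_comp] at h'
  exact ((groupHomology.functor k G (n + 1)).map_id A).symm.trans (h'.symm.trans
    ((congrArg (fun f => _ ≫ f) (hz.eq_zero_of_src _)).trans comp_zero))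

variable (N : Subgroup G) [N.Normal]

/-- The action `a ↦ g • a` on the restriction of `A` to `N`, over the conjugation by `g`. -/
def conjHom (A : Rep.{u} k G) (g : G) :
    Rep.res N.subtype A ⟶ Rep.res (MulAut.conjNormal g : MulAut N).toMonoidHom
      (Rep.res N.subtype A) :=
  Rep.ofHom ⟨A.ρ g, fun h => by
    ext x
    simp [← Module.End.mul_apply, ← map_mul]⟩

/-- The action of `g` on the homology of the normal subgroup `N` with coefficients in a representation
of `G`. -/
noncomputable def conjMap (A : Rep.{u} k G) (g : G) (n : ℕ) :
    groupHomology (Rep.res N.subtype A) n ⟶ groupHomology (Rep.res N.subtype A) n :=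
  groupHomology.map (MulAut.conjNormal g : MulAut N).toMonoidHom (conjHom N A g) n

lemma conjHom_comm {A B : Rep.{u} k G} (f : A ⟶ B) (g : G) :
    groupHomology.chainsMap (MulAut.conjNormal g : MulAut N).toMonoidHom (conjHom N A g) ≫
        groupHomology.chainsMap (MonoidHom.id N) (Rep.resMap N.subtype f) =
      groupHomology.chainsMap (MonoidHom.id N) (Rep.resMap N.subtype f) ≫
        groupHomology.chainsMap (MulAut.conjNormal g : MulAut N).toMonoidHom (conjHom N B g) := by
  rw [← groupHomology.chainsMap_comp, ← groupHomology.chainsMap_comp]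
  refine groupHomology.chainsMap_congr ?_ ?_
  · ext; rfl
  · ext x
    exact Rep.hom_comm_apply f g x

variable {X : ShortComplex (Rep.{u} k G)} (hX : X.ShortExact)

/-- The connecting homomorphism for the homology of the subgroup `N`. -/
noncomputable def resδ (n : ℕ) : groupHomology (Rep.res N.subtype X.X₃) (n + 1) ⟶
    groupHomology (Rep.res N.subtype X.X₁) n :=
  groupHomology.δ ((Rep.shortExact_res N.subtype).2 hX) (n + 1) n rfl

/-- The connecting homomorphisms commute with the action of `G`. -/
lemma conjMap_resδ (g : G) (n : ℕ) :
    conjMap N X.X₃ g (n + 1) ≫ resδ N hX n = resδ N hX n ≫ conjMap N X.X₁ g n := by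
  let Y := X.map (Rep.resFunctor N.subtype)
  have hY : Y.ShortExact := (Rep.shortExact_res N.subtype).2 hX
  let φ : Y.map (groupHomology.chainsFunctor k N) ⟶ Y.map (groupHomology.chainsFunctor k N) :=
    { τ₁ := groupHomology.chainsMap (MulAut.conjNormal g : MulAut N).toMonoidHom (conjHom N X.X₁ g)
      τ₂ := groupHomology.chainsMap (MulAut.conjNormal g : MulAut N).toMonoidHom (conjHom N X.X₂ g)
      τ₃ := groupHomology.chainsMap (MulAut.conjNormal g : MulAut N).toMonoidHom (conjHom N X.X₃ g)
      comm₁₂ := conjHom_comm N X.f g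
      comm₂₃ := conjHom_comm N X.g g }
  exact (HomologicalComplex.HomologySequence.δ_naturality φ
      (groupHomology.map_chainsFunctor_shortExact hY)
      (groupHomology.map_chainsFunctor_shortExact hY) (n + 1) n rfl).symm

lemma H0π_eq_zero_iff (A : Rep.{u} k G) (x : A) :
    groupHomology.H0π A x = 0 ↔ x ∈ Representation.Coinvariants.ker A.ρ := by
  rw [← Representation.Coinvariants.mk_eq_zero]
  have h : (groupHomology.H0Iso A).hom (groupHomology.H0π A x) =
      Representation.Coinvariants.mk A.ρ x := by
    rw [groupHomology.H0π_comp_H0Iso_hom_apply]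
  rw [← h]
  constructor
  · intro h0
    rw [h0, map_zero]
  · intro h0
    rw [← (groupHomology.H0Iso A).hom_inv_id_apply (groupHomology.H0π A x), h0, map_zero]

lemma H0π_surjective (A : Rep.{u} k G) : Function.Surjective (groupHomology.H0π A) :=
  (ModuleCat.epi_iff_surjective _).1 inferInstance

/-- The kernel of a morphism of representations. -/
abbrev kerRep {A B : Rep.{u} k G} (f : A ⟶ B) : Rep.{u} k G :=
  Rep.subrepresentation A (LinearMap.ker f.hom.toLinearMap) fun g x hx => by
    have hx' : f.hom x = 0 := hx
    change f.hom (A.ρ g x) = 0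
    rw [Rep.hom_comm_apply, hx', map_zero]

/-- The inclusion of the kernel. -/
abbrev kerRepι {A B : Rep.{u} k G} (f : A ⟶ B) : kerRep f ⟶ A := Rep.subtype _ _ _

lemma kerRepι_comp {A B : Rep.{u} k G} (f : A ⟶ B) : kerRepι f ≫ f = 0 := by
  ext x
  exact x.2

lemma kerRep_shortExact {A B : Rep.{u} k G} (f : A ⟶ B) (hf : Function.Surjective f.hom) :
    (ShortComplex.mk (kerRepι f) f (kerRepι_comp f)).ShortExact where
  exact := by
    rw [← ShortComplex.exact_map_iff_of_faithful _ (forget₂ (Rep.{u} k G) (ModuleCat.{u} k)),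
      ShortComplex.moduleCat_exact_iff]
    intro x hx
    exact ⟨⟨x, hx⟩, rfl⟩
  mono_f := (Rep.mono_iff_injective _).2 Subtype.val_injective
  epi_g := (Rep.epi_iff_surjective _).2 hf

/-- The lift of a morphism to the kernel of the next one. -/
def kerRepLift {A B C : Rep.{u} k G} (e : C ⟶ A) (f : A ⟶ B) (h : ∀ x, f.hom (e.hom x) = 0) :
    C ⟶ kerRep f :=
  Rep.ofHom ⟨e.hom.toLinearMap.codRestrict _ h, fun g => by
    ext x
    exact Rep.hom_comm_apply e g x⟩

/-- The submodule whose quotient is the module of coinvariants of the subgroup `N`. -/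
abbrev coinvKer (A : Rep.{u} k G) : Submodule k A :=
  Representation.Coinvariants.ker (A.ρ.comp N.subtype)

lemma map_mem_coinvKer {A B : Rep.{u} k G} (f : A ⟶ B) {x : A} (hx : x ∈ coinvKer N A) :
    f.hom x ∈ coinvKer N B := by
  change x ∈ (coinvKer N B).comap f.hom.toLinearMap
  refine (Submodule.span_le.2 ?_) hx
  rintro _ ⟨⟨n, y⟩, rfl⟩
  refine Representation.Coinvariants.mem_ker_of_eq n (f.hom y) _ ?_
  change _ = f.hom (A.ρ n y - y)
  rw [map_sub, Rep.hom_comm_apply]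
  rfl

lemma exists_of_mem_coinvKer {A B : Rep.{u} k G} (f : A ⟶ B) (hf : Function.Surjective f.hom)
    {y : B} (hy : y ∈ coinvKer N B) : ∃ x ∈ coinvKer N A, f.hom x = y := by
  change y ∈ (coinvKer N A).map f.hom.toLinearMap
  refine (Submodule.span_le.2 ?_) hy
  rintro _ ⟨⟨n, z⟩, rfl⟩
  obtain ⟨x, rfl⟩ := hf z
  refine ⟨A.ρ n x - x, Representation.Coinvariants.mem_ker_of_eq n x _ rfl, ?_⟩
  change f.hom (A.ρ n x - x) = _
  rw [map_sub, Rep.hom_comm_apply]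
  rfl

/-- The connecting homomorphism is injective if the middle representation is projective, because
projective representations of `G` restrict to projective representations of `N`. -/
lemma resδ_injective [Projective X.X₂] (n : ℕ) : Function.Injective (resδ N hX n).hom := by
  have hP : Projective (Rep.res N.subtype X.X₂) :=
    Functor.projective_obj (Rep.resFunctor N.subtype) X.X₂
  exact (ModuleCat.mono_iff_injective _).1 (groupHomology.mono_δ_of_isZero
    ((Rep.shortExact_res N.subtype).2 hX) n
    (isZero_groupHomology_of_projective (Rep.res N.subtype X.X₂) n))

lemma resδ_surjective [Projective X.X₂] (n : ℕ) : Function.Surjective (resδ N hX (n + 1)).hom := by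
  have hP : Projective (Rep.res N.subtype X.X₂) :=
    Functor.projective_obj (Rep.resFunctor N.subtype) X.X₂
  exact (ModuleCat.epi_iff_surjective _).1 (groupHomology.epi_δ_of_isZero
    ((Rep.shortExact_res N.subtype).2 hX) (n + 1)
    (isZero_groupHomology_of_projective (Rep.res N.subtype X.X₂) n))

/-- The class of an element of a representation in the homology of `N` in degree `0`. -/
noncomputable def resπ (A : Rep.{u} k G) : A →ₗ[k] groupHomology (Rep.res N.subtype A) 0 :=
  (groupHomology.H0π (Rep.res N.subtype A)).hom

lemma resπ_surjective (A : Rep.{u} k G) : Function.Surjective (resπ N A) := H0π_surjective _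

lemma resπ_eq_zero_iff (A : Rep.{u} k G) (x : A) : resπ N A x = 0 ↔ x ∈ coinvKer N A :=
  H0π_eq_zero_iff _ _

lemma conjMap_resπ (A : Rep.{u} k G) (g : G) (x : A) :
    conjMap N A g 0 (resπ N A x) = resπ N A (A.ρ g x) :=
  groupHomology.H0π_comp_map_apply _ (conjHom N A g) x

lemma resMap_resπ {A B : Rep.{u} k G} (f : A ⟶ B) (x : A) :
    groupHomology.map (A := Rep.res N.subtype A) (B := Rep.res N.subtype B) (MonoidHom.id N)
      (Rep.resMap N.subtype f) 0 (resπ N A x) = resπ N B (f.hom x) :=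
  groupHomology.H0π_comp_map_apply (A := Rep.res N.subtype A) (B := Rep.res N.subtype B)
    (MonoidHom.id N) (Rep.resMap N.subtype f) x

/-- Exactness of the long homology sequence in degree `0`. -/
lemma resπ_mem_range_iff (x : X.X₁) :
    resπ N X.X₁ x ∈ LinearMap.range (resδ N hX 0).hom ↔ X.f.hom x ∈ coinvKer N X.X₂ := by
  have hX' := (Rep.shortExact_res N.subtype).2 hX
  have hex : LinearMap.range (resδ N hX 0).hom = LinearMap.ker
      (groupHomology.map (A := Rep.res N.subtype X.X₁) (B := Rep.res N.subtype X.X₂)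
        (MonoidHom.id N) (Rep.resMap N.subtype X.f) 0).hom :=
    ((groupHomology.map_chainsFunctor_shortExact hX').homology_exact₁ 1 0 rfl).moduleCat_range_eq_ker
  have h : (groupHomology.map (A := Rep.res N.subtype X.X₁) (B := Rep.res N.subtype X.X₂)
      (MonoidHom.id N) (Rep.resMap N.subtype X.f) 0).hom
      (resπ N X.X₁ x) = resπ N X.X₂ (X.f.hom x) := resMap_resπ N X.f x
  rw [hex, LinearMap.mem_ker, ← resπ_eq_zero_iff, h]

lemma exists_lift_of_range_eq {D H M : Type*} [AddCommGroup D] [AddCommGroup H] [AddCommGroup M]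
    [Module k D] [Module k H] [Module k M] (δ : H →ₗ[k] M) (hδ : Function.Injective δ)
    (f : D →ₗ[k] M) (hf : LinearMap.range f = LinearMap.range δ) :
    ∃ φ : D →ₗ[k] H, (∀ x, δ (φ x) = f x) ∧ Function.Surjective φ := by
  let φ := (LinearEquiv.ofInjective δ hδ).symm.toLinearMap ∘ₗ
    f.codRestrict (LinearMap.range δ) (fun x => hf ▸ LinearMap.mem_range_self f x)
  have hφ : ∀ x, δ (φ x) = f x := fun x => by
    have := (LinearEquiv.ofInjective δ hδ).apply_symm_apply
      (f.codRestrict (LinearMap.range δ) (fun x => hf ▸ LinearMap.mem_range_self f x) x)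
    exact congrArg Subtype.val this
  refine ⟨φ, hφ, fun h => ?_⟩
  obtain ⟨x, hx⟩ : δ h ∈ LinearMap.range f := hf ▸ LinearMap.mem_range_self δ h
  exact ⟨x, hδ ((hφ x).trans hx)⟩

/-- Dimension shifting: the homology of `N` with coefficients in `A`, together with the action of `G`,
can be computed from the `N`-coinvariants of a projective resolution `K` of `A` over `G`. The homology
of the coinvariants is expressed by a surjection from the chains of `K` which become cycles in the
coinvariants, with the sums of boundaries and elements of `coinvKer` as its kernel. -/
theorem exists_map_groupHomology (r : ℕ) : ∀ (A : Rep.{u} k G) (K : ℕ → Rep.{u} k G)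
    (_ : ∀ i, Projective (K i)) (d : ∀ i, K (i + 1) ⟶ K i) (ε : K 0 ⟶ A)
    (_ : Function.Surjective ε.hom) (_ : ∀ x, ε.hom x = 0 ↔ ∃ y, (d 0).hom y = x)
    (_ : ∀ i x, (d i).hom x = 0 ↔ ∃ y, (d (i + 1)).hom y = x),
    ∃ φ : ((coinvKer N (K r)).comap (d r).hom.toLinearMap) →ₗ[k]
        groupHomology (Rep.res N.subtype A) (r + 1),
      Function.Surjective φ ∧
      (∀ x, φ x = 0 ↔ ∃ y, ∃ z ∈ coinvKer N (K (r + 1)), x.1 = (d (r + 1)).hom y + z) ∧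
      ∀ g x y, y.1 = (K (r + 1)).ρ g x.1 → φ y = conjMap N A g (r + 1) (φ x) := by
  induction r with
  | zero =>
    intro A K hK d ε hε h0 hd
    have hX := kerRep_shortExact ε hε
    have hK0 := hK 0
    let e := kerRepLift (d 0) ε fun x => (h0 _).2 ⟨x, rfl⟩
    have he : Function.Surjective e.hom := fun x => by
      obtain ⟨y, hy⟩ := (h0 _).1 x.2
      exact ⟨y, Subtype.ext hy⟩
    have hδ : Function.Injective (resδ N hX 0).hom := resδ_injective N hX 0
    let f : (coinvKer N (K 0)).comap (d 0).hom.toLinearMap →ₗ[k]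
        groupHomology (Rep.res N.subtype (kerRep ε)) 0 :=
      resπ N (kerRep ε) ∘ₗ e.hom.toLinearMap ∘ₗ Submodule.subtype _
    have hf : LinearMap.range f = LinearMap.range (resδ N hX 0).hom := by
      ext m
      constructor
      · rintro ⟨x, rfl⟩
        exact (resπ_mem_range_iff N hX (e.hom x.1)).2 x.2
      · intro hm
        obtain ⟨x, rfl⟩ := resπ_surjective N (kerRep ε) m
        obtain ⟨y, rfl⟩ := he x
        exact ⟨⟨y, (resπ_mem_range_iff N hX (e.hom y)).1 hm⟩, rfl⟩
    obtain ⟨φ, hφ, hs⟩ := exists_lift_of_range_eq _ hδ f hf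
    refine ⟨φ, hs, fun x => ?_, fun g x y hxy => hδ ?_⟩
    · rw [← map_eq_zero_iff _ hδ, hφ]
      refine (resπ_eq_zero_iff N (kerRep ε) (e.hom x.1)).trans ⟨fun h => ?_, ?_⟩
      · obtain ⟨z, hz, hzx⟩ := exists_of_mem_coinvKer N e he h
        obtain ⟨y, hy⟩ := (hd 0 (x.1 - z)).1 (by
          rw [map_sub, sub_eq_zero]
          exact (congrArg Subtype.val hzx).symm)
        exact ⟨y, z, hz, by rw [hy, sub_add_cancel]⟩
      · rintro ⟨y, z, hz, hx⟩
        have h1 : e.hom ((d 1).hom y) = 0 := Subtype.ext ((hd 0 _).2 ⟨y, rfl⟩)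
        rw [hx, map_add, h1, zero_add]
        exact map_mem_coinvKer N e hz
    · refine (hφ y).trans (Eq.trans ?_
        (ConcreteCategory.congr_hom (conjMap_resδ N hX g 0) (φ x)).symm)
      have h1 : (resδ N hX 0).hom (φ x) = resπ N (kerRep ε) (e.hom x.1) := hφ x
      have h2 : f y = resπ N (kerRep ε) ((kerRep ε).ρ g (e.hom x.1)) := by
        rw [← Rep.hom_comm_apply, ← hxy]
        rfl
      rw [h2, ← conjMap_resπ, ← h1]
      rfl
  | succ r ih =>
    intro A K hK d ε hε h0 hd
    have hX := kerRep_shortExact ε hε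
    have hK0 := hK 0
    have hδ : Function.Injective (resδ N hX (r + 1)).hom := resδ_injective N hX (r + 1)
    let e := kerRepLift (d 0) ε fun x => (h0 _).2 ⟨x, rfl⟩
    obtain ⟨f, hf, hf0, hfg⟩ := ih (kerRep ε) (fun i => K (i + 1)) (fun i => hK _)
      (fun i => d (i + 1)) e (fun x => by
        obtain ⟨y, hy⟩ := (h0 _).1 x.2
        exact ⟨y, Subtype.ext hy⟩) (fun x => by
        rw [← hd 0 x]
        exact ⟨fun h => congrArg Subtype.val h, fun h => Subtype.ext h⟩) (fun i => hd (i + 1))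
    obtain ⟨φ, hφ, hs⟩ := exists_lift_of_range_eq _ hδ f (by
      rw [LinearMap.range_eq_top.2 hf, LinearMap.range_eq_top.2 (resδ_surjective N hX r)])
    refine ⟨φ, hs, fun x => ?_, fun g x y hxy => hδ ?_⟩
    · rw [← hf0, ← hφ, map_eq_zero_iff _ hδ]
    · rw [hφ, hfg g x y hxy, ← hφ]
      exact (ConcreteCategory.congr_hom (conjMap_resδ N hX g (r + 1)) (φ x)).symm

lemma conjMap_trivial (n : ℕ) (g : G) :
    conjMap N (Rep.trivial k G k) g n = homologyAut k N n (MulAut.conjNormal g) := by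
  unfold conjMap homologyAut
  rfl

lemma conjRep_apply (n : ℕ) (g : G) (x : groupHomology (Rep.trivial k N k) n) :
    conjRep k N n g x = conjMap N (Rep.trivial k G k) g n x := by
  rw [conjMap_trivial]
  rfl

/-- Dimension shifting for trivial coefficients, in terms of `conjRep`. -/
theorem exists_map_groupHomology_trivial (r : ℕ) (K : ℕ → Rep.{u} k G)
    (hK : ∀ i, Projective (K i)) (d : ∀ i, K (i + 1) ⟶ K i) (ε : K 0 ⟶ Rep.trivial k G k)
    (hε : Function.Surjective ε.hom) (h0 : ∀ x, ε.hom x = 0 ↔ ∃ y, (d 0).hom y = x)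
    (hd : ∀ i x, (d i).hom x = 0 ↔ ∃ y, (d (i + 1)).hom y = x) :
    ∃ φ : ((coinvKer N (K r)).comap (d r).hom.toLinearMap) →ₗ[k]
        groupHomology (Rep.trivial k N k) (r + 1),
      Function.Surjective φ ∧
      (∀ x, φ x = 0 ↔ ∃ y, ∃ z ∈ coinvKer N (K (r + 1)), x.1 = (d (r + 1)).hom y + z) ∧
      ∀ g x y, y.1 = (K (r + 1)).ρ g x.1 → φ y = conjRep k N (r + 1) g (φ x) := by
  obtain ⟨φ, hs, hk, hg⟩ := exists_map_groupHomology N r (Rep.trivial k G k) K hK d ε hε h0 hd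
  refine ⟨φ, hs, hk, fun g x y h => ?_⟩
  rw [conjRep_apply]
  exact hg g x y h

end Shift

/-! ### The Koszul complex of a graph and its coinvariants -/

section KoszulComplex

variable {V : Type u} [LinearOrder V] (Γ : SimpleGraph V) {R S : Type u} [Ring R] [Ring S]

/-- The Koszul-type differential on the free left `R`-modules on the cliques of `Γ`. For `x v = v - 1`
in the group ring of the Artin group, this is the cellular differential of the universal cover of the
Salvetti complex; for `x v = 1`, it is the simplicial boundary of the flag complex. -/
noncomputable def koszul (x : V → R) (m : ℕ) :
    ({s : Finset V // Γ.IsNClique (m + 1) s} →₀ R) →ₗ[R] ({s : Finset V // Γ.IsNClique m s} →₀ R) :=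
  linearCombination R fun s => ∑ v ∈ s.1.attach,
    single (face s v) ((-1) ^ (s.1.filter (· < v.1)).card * x v.1)

variable {Γ}

lemma koszul_single (x : V → R) (m : ℕ) (s : {s : Finset V // Γ.IsNClique (m + 1) s}) (a : R) :
    koszul Γ x m (single s a) = ∑ v ∈ s.1.attach,
      single (face s v) ((-1) ^ (s.1.filter (· < v.1)).card * (a * x v.1)) := by
  simp only [koszul, linearCombination_single, Finset.smul_sum, smul_single, smul_eq_mul]
  refine Finset.sum_congr rfl fun v _ => ?_
  rw [← mul_assoc, ← mul_assoc, ((Commute.neg_one_right a).pow_right _).eq]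

lemma mapRange_koszul (f : R →+* S) (x : V → R) (m : ℕ)
    (y : {s : Finset V // Γ.IsNClique (m + 1) s} →₀ R) :
    mapRange.addMonoidHom f.toAddMonoidHom (koszul Γ x m y) =
      koszul Γ (fun v => f (x v)) m (mapRange.addMonoidHom f.toAddMonoidHom y) := by
  induction y using Finsupp.induction_linear with
  | zero => simp
  | add y z hy hz => simp only [map_add, hy, hz]
  | single s a =>
    have h : ∀ {n : ℕ} (s : {s : Finset V // Γ.IsNClique n s}) (b : R),
        mapRange.addMonoidHom f.toAddMonoidHom (single s b) = single s (f b) := fun s b => by simp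
    rw [koszul_single, map_sum, h, koszul_single]
    refine Finset.sum_congr rfl fun v _ => ?_
    rw [h]
    simp

/-- The inclusion of the chains on cliques into the chains on all finite sets of vertices. -/
noncomputable def toTotal (Γ : SimpleGraph V) (R : Type u) [Ring R] (m : ℕ) :
    ({s : Finset V // Γ.IsNClique m s} →₀ R) →ₗ[R] (Finset V →₀ R) :=
  lmapDomain R R Subtype.val

lemma toTotal_injective (m : ℕ) : Function.Injective (toTotal Γ R m) :=
  mapDomain_injective Subtype.val_injective

lemma toTotal_single (m : ℕ) (s : {s : Finset V // Γ.IsNClique m s}) (a : R) :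
    toTotal Γ R m (single s a) = single s.1 a := by
  simp [toTotal]

lemma totalKoszul_toTotal (x : V → R) (m : ℕ) (y : {s : Finset V // Γ.IsNClique (m + 1) s} →₀ R) :
    totalKoszul x (toTotal Γ R (m + 1) y) = toTotal Γ R m (koszul Γ x m y) := by
  induction y using Finsupp.induction_linear with
  | zero => simp
  | add y z hy hz => simp only [map_add, hy, hz]
  | single s a =>
    rw [koszul_single, map_sum, toTotal_single, totalKoszul_single, ← Finset.sum_attach]
    refine Finset.sum_congr rfl fun v _ => ?_
    rw [toTotal_single]
    rfl

lemma range_toTotal [Fintype V] (m : ℕ) :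
    LinearMap.range (toTotal Γ R m) = cliqueChains Γ R Finset.univ m := by
  rw [cliqueChains_eq_span, toTotal, LinearMap.range_eq_map, ← Finsupp.supported_univ,
    supported_eq_span_single, Submodule.map_span, ← Set.image_comp]
  congr 1
  ext y
  constructor
  · rintro ⟨s, -, rfl⟩
    exact ⟨s.1, ⟨Finset.subset_univ _, s.2⟩, by simp⟩
  · rintro ⟨s, hs, rfl⟩
    exact ⟨⟨s, hs.2⟩, trivial, by simp⟩

lemma koszul_eq_zero_iff [Finite V] (x : V → R) (hx : ∀ v w, Γ.Adj v w → x v * x w = x w * x v)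
    (hreg : ∀ (S : Finset V) (v : V) (_ : DecidableRel Γ.Adj), v ∉ S → ∀ a, a * x v ∈ genIdeal x S →
      a ∈ genIdeal x (S.filter (Γ.Adj v))) (m : ℕ)
    (y : {s : Finset V // Γ.IsNClique (m + 1) s} →₀ R) :
    koszul Γ x m y = 0 ↔ ∃ z, koszul Γ x (m + 1) z = y := by
  classical
  have := Fintype.ofFinite V
  have hmem : ∀ {m : ℕ} (z : {s : Finset V // Γ.IsNClique m s} →₀ R),
      toTotal Γ R m z ∈ cliqueChains Γ R Finset.univ m := fun z =>
    range_toTotal (Γ := Γ) (R := R) _ ▸ LinearMap.mem_range_self _ z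
  constructor
  · intro hy
    obtain ⟨z, hz, hzy⟩ := exists_totalKoszul_eq x hx
      (fun S v hv => hreg S v _ fun h => lt_irrefl _ (hv v h)) Finset.univ m
      (toTotal Γ R (m + 1) y) (hmem y) (by rw [totalKoszul_toTotal, hy, map_zero])
    rw [← range_toTotal] at hz
    obtain ⟨z, rfl⟩ := hz
    rw [totalKoszul_toTotal] at hzy
    exact ⟨z, toTotal_injective _ hzy⟩
  · rintro ⟨z, rfl⟩
    apply toTotal_injective
    rw [← totalKoszul_toTotal, ← totalKoszul_toTotal, map_zero,
      totalKoszul_totalKoszul x hx _ _ _ (hmem z)]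

/-- The image of the first differential contains the left ideal generated by `x`. -/
lemma koszul_zero_range [Fintype V] (x : V → R) (a : R) (e : {s : Finset V // Γ.IsNClique 0 s})
    (ha : a ∈ genIdeal x Finset.univ) : ∃ z, koszul Γ x 0 z = single e a := by
  classical
  have h : single ∅ a ∈ (genIdeal x Finset.univ).map (lsingle (R := R) (∅ : Finset V)) := ⟨a, ha, rfl⟩
  rw [← map_totalKoszul_one (Γ := Γ), ← range_toTotal] at h
  obtain ⟨_, ⟨z, rfl⟩, hz⟩ := h
  refine ⟨z, toTotal_injective _ ?_⟩
  rw [← totalKoszul_toTotal, toTotal_single, hz, Finset.card_eq_zero.1 e.2.card_eq]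

end KoszulComplex

section Resolution

variable {V : Type u} [LinearOrder V] (Γ : SimpleGraph V) (k : Type u) [CommRing k]

/-- The augmentation of a group ring, which sends each group element to `1`. -/
noncomputable def augmentation (G : Type*) [Group G] : MonoidAlgebra k G →ₐ[k] k :=
  MonoidAlgebra.lift k k G 1

lemma augmentation_of {G : Type*} [Group G] (g : G) : augmentation k G (MonoidAlgebra.of k G g) = 1 := by
  simp [augmentation]

lemma sub_augmentation_mem {G : Type*} [Group G] (J : Submodule (MonoidAlgebra k G) (MonoidAlgebra k G))
    (hJ : ∀ g, MonoidAlgebra.of k G g - 1 ∈ J) (a : MonoidAlgebra k G) :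
    a - algebraMap k _ (augmentation k G a) ∈ J := by
  induction a using MonoidAlgebra.induction_on with
  | of g => rw [augmentation_of, map_one]; exact hJ g
  | add a b ha hb =>
    rw [map_add, map_add, add_sub_add_comm]
    exact J.add_mem ha hb
  | smul r a ha =>
    rw [map_smul, smul_eq_mul, map_mul, ← Algebra.smul_def, ← smul_sub]
    exact J.smul_of_tower_mem r ha

/-- The augmentation ideal is generated, as a left ideal, by the `v - 1` for the vertices `v`. -/
lemma of_sub_one_mem_genIdeal [Fintype V] (g : ArtinGroup Γ) :
    MonoidAlgebra.of k _ g - 1 ∈ genIdeal (vertexSubOne Γ k) Finset.univ := by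
  set J := genIdeal (vertexSubOne Γ k) Finset.univ
  have hinv : ∀ g : ArtinGroup Γ, MonoidAlgebra.of k _ g - 1 ∈ J → MonoidAlgebra.of k _ g⁻¹ - 1 ∈ J := by
    intro g hg
    have := J.neg_mem (J.smul_mem (MonoidAlgebra.of k _ g⁻¹) hg)
    rwa [smul_eq_mul, mul_sub, ← map_mul, inv_mul_cancel, map_one, mul_one, neg_sub] at this
  induction g using PresentedGroup.induction_on with
  | _ z =>
  induction z using FreeGroup.induction_on with
  | C1 => rw [map_one, map_one, sub_self]; exact J.zero_mem
  | of w => exact Submodule.subset_span ⟨w, by simp, rfl⟩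
  | inv_of w ih =>
    rw [map_inv]
    exact hinv _ ih
  | mul x y hx hy =>
    rw [map_mul]
    have := J.add_mem (J.smul_mem (MonoidAlgebra.of k _ (PresentedGroup.mk _ x)) hy) hx
    rwa [smul_eq_mul, mul_sub, ← map_mul, mul_one, sub_add_sub_cancel] at this

lemma free_ρ {G α : Type u} [Group G] (g : G) (x : α →₀ MonoidAlgebra k G) :
    (Rep.free k G α).ρ g x = MonoidAlgebra.of k G g • x := by
  induction x using Finsupp.induction_linear with
  | zero => simp
  | add x y hx hy => rw [map_add, hx, hy, smul_add]
  | single a x => 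
    induction x using MonoidAlgebra.induction_linear with
    | zero => simp
    | add x y hx hy => rw [single_add, map_add, hx, hy, smul_add]
    | single h r => simp

/-- A linear map over the group ring as a morphism of representations. -/
noncomputable def freeHom {G α β : Type u} [Group G]
    (f : (α →₀ MonoidAlgebra k G) →ₗ[MonoidAlgebra k G] (β →₀ MonoidAlgebra k G)) :
    Rep.free k G α ⟶ Rep.free k G β :=
  Rep.ofHom ⟨f.restrictScalars k, fun g => by
    refine LinearMap.ext fun x => ?_
    change f ((Rep.free k G α).ρ g x) = (Rep.free k G β).ρ g (f x)
    rw [free_ρ, free_ρ, map_smul]⟩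

/-- The augmentation of the coefficient at `a`, as a morphism to the trivial representation. It is used
for the resolution in degree `0`, where the empty clique `a` is the only basis element. -/
noncomputable def freeAugmentation {G α : Type u} [Group G] (a : α) :
    Rep.free k G α ⟶ Rep.trivial k G k :=
  Rep.ofHom ⟨(augmentation k G).toLinearMap ∘ₗ lapply a, fun g => by
    refine LinearMap.ext fun x => ?_
    change augmentation k G ((Rep.free k G α).ρ g x a) = augmentation k G (x a)
    rw [free_ρ, Finsupp.smul_apply, smul_eq_mul, map_mul, augmentation_of, one_mul]⟩

/-- The change of coefficients along the ring homomorphism `k[G] → k[Z]` induced by `ℓ`. -/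
noncomputable def reduceCoeff {G Z : Type*} [Group G] [Group Z] (ℓ : G →* Z) (α : Type*) :
    (α →₀ MonoidAlgebra k G) →ₗ[k] (α →₀ MonoidAlgebra k Z) :=
  mapRange.linearMap (MonoidAlgebra.mapDomainAlgHom k k ℓ).toLinearMap

variable {k}

lemma reduceCoeff_single {G Z α : Type*} [Group G] [Group Z] (ℓ : G →* Z) (a : α)
    (b : MonoidAlgebra k G) :
    reduceCoeff k ℓ α (single a b) = single a (MonoidAlgebra.mapDomainAlgHom k k ℓ b) := by
  simp [reduceCoeff]

lemma reduceCoeff_smul {G Z α : Type*} [Group G] [Group Z] (ℓ : G →* Z) (b : MonoidAlgebra k G)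
    (x : α →₀ MonoidAlgebra k G) :
    reduceCoeff k ℓ α (b • x) = MonoidAlgebra.mapDomainAlgHom k k ℓ b • reduceCoeff k ℓ α x := by
  ext1 a
  exact map_mul (MonoidAlgebra.mapDomainAlgHom k k ℓ) b (x a)

lemma mapDomainAlgHom_of {G Z : Type*} [Group G] [Group Z] (ℓ : G →* Z) (g : G) :
    MonoidAlgebra.mapDomainAlgHom k k ℓ (MonoidAlgebra.of k G g) = MonoidAlgebra.of k Z (ℓ g) := by
  simp

lemma reduceCoeff_surjective {G Z α : Type*} [Group G] [Group Z] (ℓ : G →* Z)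
    (hℓ : Function.Surjective ℓ) : Function.Surjective (reduceCoeff k ℓ α) := by
  have h : Function.Surjective (MonoidAlgebra.mapDomainAlgHom k k ℓ) := by
    intro b
    induction b using MonoidAlgebra.induction_on with
    | of z =>
      obtain ⟨g, rfl⟩ := hℓ z
      exact ⟨_, mapDomainAlgHom_of ℓ g⟩
    | add a b ha hb =>
      obtain ⟨a, rfl⟩ := ha
      obtain ⟨b, rfl⟩ := hb
      exact ⟨a + b, map_add _ _ _⟩
    | smul r b hb =>
      obtain ⟨b, rfl⟩ := hb
      exact ⟨r • b, map_smul _ _ _⟩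
  exact mapRange_surjective _ (map_zero _) h

/-- The coinvariants of a free representation of `G` under the kernel of `ℓ : G → Z` are the free module
over `k[Z]` on the same basis. -/
lemma mem_coinvKer_free_iff {G α : Type u} [Group G] {Z : Type*} [Group Z] (ℓ : G →* Z)
    (hℓ : Function.Surjective ℓ) (x : α →₀ MonoidAlgebra k G) :
    x ∈ coinvKer ℓ.ker (Rep.free k G α) ↔ reduceCoeff k ℓ α x = 0 := by
  constructor
  · intro hx
    change x ∈ LinearMap.ker (reduceCoeff k ℓ α)
    refine (Submodule.span_le.2 ?_) hx
    rintro _ ⟨⟨n, y⟩, rfl⟩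
    change reduceCoeff k ℓ α ((Rep.free k G α).ρ n.1 y - y) = 0
    rw [free_ρ, map_sub, reduceCoeff_smul, mapDomainAlgHom_of, (MonoidHom.mem_ker).1 n.2, map_one,
      one_smul, sub_self]
  · intro hx
    let σ : MonoidAlgebra k Z →ₗ[k] MonoidAlgebra k G :=
      MonoidAlgebra.mapDomainLinearMap k k (Function.surjInv hℓ)
    have hσ : ∀ z, σ (MonoidAlgebra.of k Z z) = MonoidAlgebra.of k G (Function.surjInv hℓ z) :=
      fun z => by simp [σ]
    -- Modulo `coinvKer`, each group element can be replaced by a chosen one with the same image in `Z`.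
    let mk := (coinvKer ℓ.ker (Rep.free k G α)).mkQ
    have key : ∀ x : α →₀ MonoidAlgebra k G, mk (mapRange.linearMap σ (reduceCoeff k ℓ α x)) = mk x := by
      intro x
      induction x using Finsupp.induction_linear with
      | zero => simp
      | add x y hx hy => simp only [map_add, hx, hy]
      | single a b =>
        rw [reduceCoeff_single, mapRange.linearMap_apply, mapRange_single]
        induction b using MonoidAlgebra.induction_on with
        | of g =>
          rw [mapDomainAlgHom_of, hσ]
          refine (Submodule.Quotient.eq _).2 ?_
          refine Representation.Coinvariants.mem_ker_of_eq
            (⟨Function.surjInv hℓ (ℓ g) * g⁻¹, ?_⟩ : ℓ.ker) (single a (MonoidAlgebra.of k G g)) _ ?_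
          · rw [MonoidHom.mem_ker, map_mul, Function.surjInv_eq hℓ, map_inv, mul_inv_cancel]
          · change (Rep.free k G α).ρ _ _ - _ = _
            rw [free_ρ, smul_single, smul_eq_mul, ← map_mul, Subgroup.subtype_apply, inv_mul_cancel_right]
        | add b c hb hc => simp only [map_add, single_add, hb, hc]
        | smul r b hb =>
          rw [map_smul, map_smul, ← smul_single, ← smul_single, map_smul, map_smul, hb]
    refine (Submodule.Quotient.mk_eq_zero _).1 ((key x).symm.trans ?_)
    rw [hx, map_zero, map_zero]

end Resolution

/-! ### The homology of the Bestvina-Brady group -/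

section Homology

variable {V : Type u} [LinearOrder V] (Γ : SimpleGraph V) (k : Type u)

/-- The element `t - 1` of the group ring of the integers. -/
noncomputable def tSubOne [CommRing k] : MonoidAlgebra k (Multiplicative ℤ) :=
  MonoidAlgebra.of k _ (Multiplicative.ofAdd 1) - 1

lemma reduceCoeff_koszul [CommRing k] (m : ℕ)
    (y : {s : Finset V // Γ.IsNClique (m + 1) s} →₀ MonoidAlgebra k (ArtinGroup Γ)) :
    reduceCoeff k (length Γ) _ (koszul Γ (vertexSubOne Γ k) m y) =
      koszul Γ (fun _ => tSubOne k) m (reduceCoeff k (length Γ) _ y) := by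
  have h := mapRange_koszul (MonoidAlgebra.mapDomainAlgHom k k (length Γ)).toRingHom
    (vertexSubOne Γ k) m y
  have h2 : (fun v => (MonoidAlgebra.mapDomainAlgHom k k (length Γ)).toRingHom (vertexSubOne Γ k v)) =
      fun _ => tSubOne k := by
    funext v
    change MonoidAlgebra.mapDomainAlgHom k k (length Γ) (vertexSubOne Γ k v) = _
    rw [vertexSubOne, map_sub, mapDomainAlgHom_of, length_of]
    exact congrArg _ (map_one (MonoidAlgebra.mapDomainAlgHom k k (length Γ)))
  rw [h2] at h
  exact h

variable [Field k] [Finite V]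

/-- The homology of the Bestvina-Brady group in degree `r + 1`, as a module over `k[ℤ]`, is the homology
of the Koszul complex over `k[ℤ]` in which each vertex acts by `t - 1`. -/
theorem exists_map_homologyRep [Nonempty V] (r : ℕ) :
    ∃ φ : LinearMap.ker (koszul Γ (fun _ => tSubOne k) r) →ₗ[MonoidAlgebra k (Multiplicative ℤ)]
        (homologyRep Γ k (r + 1)).asModule,
      Function.Surjective φ ∧
      ∀ q, φ q = 0 ↔ ∃ y, koszul Γ (fun _ => tSubOne k) (r + 1) y = q.1 := by
  classical
  have := Fintype.ofFinite V
  let G := ArtinGroup Γ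
  let ℓ := length Γ
  have hℓ := length_surjective Γ
  let K : ℕ → Rep.{u} k G := fun i => Rep.free k G {s : Finset V // Γ.IsNClique i s}
  let d : ∀ i, K (i + 1) ⟶ K i := fun i => freeHom k (koszul Γ (vertexSubOne Γ k) i)
  let e : {s : Finset V // Γ.IsNClique 0 s} := ⟨∅, by simp⟩
  let ε : K 0 ⟶ Rep.trivial k G k := freeAugmentation k e
  have he : ∀ x : {s : Finset V // Γ.IsNClique 0 s} →₀ MonoidAlgebra k G, single e (x e) = x := by
    intro x
    ext1 s
    obtain rfl : s = e := Subtype.ext (Finset.card_eq_zero.1 s.2.card_eq)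
    simp
  have hε : Function.Surjective ε.hom := fun r => by
    refine ⟨single e (algebraMap k _ r), ?_⟩
    change augmentation k G ((single e (algebraMap k _ r) : _ →₀ _) e) = r
    rw [single_eq_same, AlgHom.commutes]
    rfl
  have h0 : ∀ x, ε.hom x = 0 ↔ ∃ y, (d 0).hom y = x := by
    intro x
    constructor
    · intro hx
      have hx' : augmentation k G (x e) = 0 := hx
      have hm := sub_augmentation_mem k (genIdeal (vertexSubOne Γ k) Finset.univ)
        (of_sub_one_mem_genIdeal Γ k) (x e)
      rw [hx', map_zero, sub_zero] at hm
      obtain ⟨z, hz⟩ := koszul_zero_range (Γ := Γ) (vertexSubOne Γ k) (x e) e hm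
      exact ⟨z, hz.trans (he x)⟩
    · rintro ⟨y, rfl⟩
      change augmentation k G (koszul Γ (vertexSubOne Γ k) 0 y e) = 0
      induction y using Finsupp.induction_linear with
      | zero => simp
      | add y z hy hz => rw [map_add, Finsupp.add_apply, map_add, hy, hz, add_zero]
      | single s a =>
        rw [koszul_single, Finsupp.finsetSum_apply, map_sum]
        refine Finset.sum_eq_zero fun v _ => ?_
        have hf : face s v = e := Subtype.ext (Finset.card_eq_zero.1 (face s v).2.card_eq)
        rw [hf, single_eq_same, map_mul, map_mul, vertexSubOne, map_sub, augmentation_of, map_one,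
          sub_self, mul_zero, mul_zero]
  obtain ⟨φ, hs, hk, hg⟩ := exists_map_groupHomology_trivial (bbGroup Γ) r K
    (fun i => Rep.free_projective) d ε hε h0 (fun i x => koszul_eq_zero_iff (vertexSubOne Γ k)
      (vertexSubOne_comm Γ k) (fun S v _ hv a ha => mem_genIdeal_of_mul_mem Γ k S v hv a ha) i x)
  let π : ∀ i, K i →ₗ[k] ({s : Finset V // Γ.IsNClique i s} →₀ MonoidAlgebra k (Multiplicative ℤ)) :=
    fun i => reduceCoeff k ℓ _
  have hπ : ∀ i x, x ∈ coinvKer (bbGroup Γ) (K i) ↔ π i x = 0 := fun i x =>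
    mem_coinvKer_free_iff ℓ hℓ x
  have hD : ∀ x : K (r + 1), x ∈ (coinvKer (bbGroup Γ) (K r)).comap (d r).hom.toLinearMap ↔
      koszul Γ (fun _ => tSubOne k) r (π (r + 1) x) = 0 := fun x =>
    (hπ r _).trans (Eq.congr_left (reduceCoeff_koszul Γ k r x))
  obtain ⟨σ, hσ⟩ := (π (r + 1)).exists_rightInverse_of_surjective
    (LinearMap.range_eq_top.2 (reduceCoeff_surjective ℓ hℓ))
  have hσ' : ∀ q, π (r + 1) (σ q) = q := LinearMap.congr_fun hσ
  let M := LinearMap.ker (koszul Γ (fun _ => tSubOne k) r)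
  -- `φ` does not depend on the choice of the lift `σ` along `π`, so it descends to `M`.
  let σ' : M →ₗ[k] ((coinvKer (bbGroup Γ) (K r)).comap (d r).hom.toLinearMap) :=
    (σ ∘ₗ M.subtype.restrictScalars k).codRestrict _ fun q => (hD _).2 (by
      change koszul Γ (fun _ => tSubOne k) r (π (r + 1) (σ q.1)) = 0
      rw [hσ']
      exact q.2)
  let φ₀ : M →ₗ[k] (homologyRep Γ k (r + 1)).asModule :=
    (homologyRep Γ k (r + 1)).asModuleEquiv.symm.toLinearMap ∘ₗ φ ∘ₗ σ'
  have hφ₀ : ∀ (q : M) x, π (r + 1) x.1 = q.1 →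
      φ₀ q = (homologyRep Γ k (r + 1)).asModuleEquiv.symm (φ x) := by
    intro q x hx
    refine congrArg (homologyRep Γ k (r + 1)).asModuleEquiv.symm (sub_eq_zero.1 ?_)
    change φ (σ' q) - φ x = 0
    rw [← map_sub]
    refine (hk _).2 ⟨0, σ q.1 - x.1, (hπ _ _).2 ?_, ?_⟩
    · rw [map_sub, hσ', hx, sub_self]
    · rw [map_zero, zero_add]
      rfl
  let φ₁ := MonoidAlgebra.equivariantOfLinearOfComm φ₀ (fun z q => by
    obtain ⟨g, rfl⟩ := hℓ z
    have hq : π (r + 1) ((K (r + 1)).ρ g (σ q.1)) = (MonoidAlgebra.single (length Γ g) (1 : k) • q).1 := by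
      have : (K (r + 1)).ρ g (σ q.1) = MonoidAlgebra.of k G g • (show _ →₀ MonoidAlgebra k G from σ q.1) :=
        free_ρ k g _
      rw [this]
      refine (reduceCoeff_smul _ _ _).trans ?_
      rw [mapDomainAlgHom_of]
      exact congrArg _ (hσ' q.1)
    rw [hφ₀ (MonoidAlgebra.single (length Γ g) (1 : k) • q) ⟨(K (r + 1)).ρ g (σ q.1), (hD _).2 (by
        rw [hq]; exact (MonoidAlgebra.single (length Γ g) (1 : k) • q).2)⟩ hq,
      hg g (σ' q) _ rfl, Representation.single_smul, one_smul, homologyRep_length]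
    rfl)
  refine ⟨φ₁, fun h => ?_, fun q => ?_⟩
  · obtain ⟨x, hx⟩ := hs ((homologyRep Γ k (r + 1)).asModuleEquiv h)
    refine ⟨⟨π (r + 1) x.1, (hD _).1 x.2⟩, (hφ₀ _ x rfl).trans ?_⟩
    rw [hx, LinearEquiv.symm_apply_apply]
  · change φ₀ q = 0 ↔ _
    rw [hφ₀ q (σ' q) (hσ' q.1), LinearEquiv.map_eq_zero_iff, hk]
    constructor
    · rintro ⟨y, z, hz, h⟩
      refine ⟨π (r + 2) y, ?_⟩
      rw [← hσ' q.1, show σ q.1 = _ from h, map_add, (hπ _ _).1 hz, add_zero]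
      exact (reduceCoeff_koszul Γ k (r + 1) y).symm
    · rintro ⟨y, hy⟩
      obtain ⟨y, rfl⟩ := reduceCoeff_surjective (k := k) ℓ hℓ y
      refine ⟨y, σ q.1 - (d (r + 1)).hom y, (hπ _ _).2 ?_, (add_sub_cancel _ _).symm⟩
      rw [map_sub, hσ', ← hy, sub_eq_zero]
      exact (reduceCoeff_koszul Γ k (r + 1) y).symm

end Homology

/-! ### Extension of scalars and splitting of complexes of vector spaces -/

section Extension

variable {k : Type*} [CommRing k] (R : Type*) [CommRing R] [Algebra k R] {α β γ : Type*}

/-- The inclusion of the chains with coefficients in `k` into the chains with coefficients in `R`. -/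
noncomputable def inclCoeff (k : Type*) [CommRing k] (R : Type*) [CommRing R] [Algebra k R]
    (α : Type*) : (α →₀ k) →ₗ[k] (α →₀ R) :=
  mapRange.linearMap (Algebra.linearMap k R)

/-- The extension of scalars from `k` to `R` of a linear map between free modules with given bases. -/
noncomputable def extend (f : (α →₀ k) →ₗ[k] (β →₀ k)) : (α →₀ R) →ₗ[R] (β →₀ R) :=
  linearCombination R fun a => inclCoeff k R β (f (single a 1))

lemma inclCoeff_single (a : α) (c : k) :
    inclCoeff k R α (single a c) = single a (algebraMap k R c) := by
  simp [inclCoeff]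

lemma extend_inclCoeff (f : (α →₀ k) →ₗ[k] (β →₀ k)) (c : α →₀ k) :
    extend R f (inclCoeff k R α c) = inclCoeff k R β (f c) := by
  induction c using Finsupp.induction_linear with
  | zero => simp
  | add c d hc hd => simp only [map_add, hc, hd]
  | single a c =>
    rw [inclCoeff_single, extend, linearCombination_single, algebraMap_smul, ← map_smul, ← map_smul,
      smul_single, smul_eq_mul, mul_one]

lemma extend_comp (f : (β →₀ k) →ₗ[k] (γ →₀ k)) (g : (α →₀ k) →ₗ[k] (β →₀ k)) :
    extend R (f ∘ₗ g) = extend R f ∘ₗ extend R g := by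
  refine Finsupp.lhom_ext' fun a => LinearMap.ext_ring ?_
  simp only [LinearMap.comp_apply, lsingle_apply]
  rw [extend, linearCombination_single, one_smul, LinearMap.comp_apply, ← extend_inclCoeff]
  congr 1
  rw [extend, linearCombination_single, one_smul]

lemma extend_id : extend R (LinearMap.id : (α →₀ k) →ₗ[k] (α →₀ k)) = LinearMap.id := by
  refine Finsupp.lhom_ext' fun a => LinearMap.ext_ring ?_
  simp [extend, inclCoeff_single]

lemma extend_add (f g : (α →₀ k) →ₗ[k] (β →₀ k)) :
    extend R (f + g) = extend R f + extend R g := by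
  refine Finsupp.lhom_ext' fun a => LinearMap.ext_ring ?_
  simp [extend]

lemma extend_zero : extend R (0 : (α →₀ k) →ₗ[k] (β →₀ k)) = 0 := by
  refine Finsupp.lhom_ext' fun a => LinearMap.ext_ring ?_
  simp [extend]

end Extension

section Splitting

/-- A splitting of a complex `C₂ → C₁ → C₀` of vector spaces at the middle: `ι` is a basis of a
complement of the boundaries in the cycles, `κ` is a basis of the boundaries, `p` and `q` are the
coordinates for these bases, and `s` is a generalized inverse of `f₀`. All properties are identities
between linear maps, so that they persist under extension of scalars. -/
lemma exists_splitting {k C₀ C₁ C₂ : Type*} [Field k] [AddCommGroup C₀] [AddCommGroup C₁]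
    [AddCommGroup C₂] [Module k C₀] [Module k C₁] [Module k C₂] [Module.Finite k C₁]
    (f₀ : C₁ →ₗ[k] C₀) (f₁ : C₂ →ₗ[k] C₁) (hf : f₀ ∘ₗ f₁ = 0) (h b : ℕ)
    (hh : Module.finrank k (LinearMap.ker f₀) = h + b)
    (hb : Module.finrank k (LinearMap.range f₁) = b) :
    ∃ (ι : (Fin h →₀ k) →ₗ[k] C₁) (κ : (Fin b →₀ k) →ₗ[k] C₁) (p : C₁ →ₗ[k] (Fin h →₀ k))
      (q : C₁ →ₗ[k] (Fin b →₀ k)) (s : C₀ →ₗ[k] C₁) (w : C₂ →ₗ[k] (Fin b →₀ k))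
      (w' : (Fin b →₀ k) →ₗ[k] C₂),
      p ∘ₗ ι = LinearMap.id ∧ p ∘ₗ κ = 0 ∧ q ∘ₗ ι = 0 ∧ q ∘ₗ κ = LinearMap.id ∧
      f₀ ∘ₗ ι = 0 ∧ f₁ = κ ∘ₗ w ∧ κ = f₁ ∘ₗ w' ∧
      ι ∘ₗ p + κ ∘ₗ q + s ∘ₗ f₀ = LinearMap.id := by
  set Z := LinearMap.ker f₀
  set B := (LinearMap.range f₁).submoduleOf Z
  have hBZ : LinearMap.range f₁ ≤ Z := by
    rintro _ ⟨x, rfl⟩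
    exact LinearMap.congr_fun hf x
  obtain ⟨W, hW⟩ := B.exists_isCompl
  obtain ⟨s₀, hs₀⟩ := f₀.rangeRestrict.exists_rightInverse_of_surjective f₀.range_rangeRestrict
  obtain ⟨s, hs⟩ := s₀.exists_extend
  have hs' : ∀ x, f₀ (s (f₀ x)) = f₀ x := fun x => by
    have h1 : s (f₀ x) = s₀ (f₀.rangeRestrict x) := LinearMap.congr_fun hs (f₀.rangeRestrict x)
    rw [h1]
    exact congrArg Subtype.val (LinearMap.congr_fun hs₀ (f₀.rangeRestrict x))
  -- the projection of `C₁` onto the cycles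
  let z : C₁ →ₗ[k] Z := (LinearMap.id - s ∘ₗ f₀).codRestrict Z fun x => by
    change f₀ (x - s (f₀ x)) = 0
    rw [map_sub, hs', sub_self]
  have hz : ∀ x : Z, z x = x := fun x => Subtype.ext (by
    change x.1 - s (f₀ x.1) = x.1
    rw [show f₀ x.1 = 0 from x.2, map_zero, sub_zero])
  have hBb : Module.finrank k B = b := by
    rw [← hb]
    exact (Submodule.submoduleOfEquivOfLe hBZ).finrank_eq
  have hWh : Module.finrank k W = h := by
    have := Submodule.finrank_add_eq_of_isCompl hW
    omega
  let eW : (Fin h →₀ k) ≃ₗ[k] W := (Module.finBasisOfFinrankEq k W hWh).repr.symm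
  let eB : (Fin b →₀ k) ≃ₗ[k] B := (Module.finBasisOfFinrankEq k B hBb).repr.symm
  let e : ((Fin b →₀ k) × (Fin h →₀ k)) ≃ₗ[k] Z :=
    (eB.prodCongr eW).trans (Submodule.prodEquivOfIsCompl B W hW)
  let ι : (Fin h →₀ k) →ₗ[k] C₁ := Z.subtype ∘ₗ e.toLinearMap ∘ₗ LinearMap.inr k _ _
  let κ : (Fin b →₀ k) →ₗ[k] C₁ := Z.subtype ∘ₗ e.toLinearMap ∘ₗ LinearMap.inl k _ _
  have hκ : LinearMap.range κ = LinearMap.range f₁ := by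
    have h1 : ∀ c, κ c = (eB c).1.1 := fun c => by
      simp [κ, e]
    ext x
    constructor
    · rintro ⟨c, rfl⟩
      rw [h1]
      exact (eB c).2
    · intro hx
      exact ⟨eB.symm ⟨⟨x, hBZ hx⟩, hx⟩, by rw [h1, LinearEquiv.apply_symm_apply]⟩
  have hκi : Function.Injective κ :=
    Subtype.val_injective.comp (e.injective.comp LinearMap.inl_injective)
  obtain ⟨w, hw, -⟩ := exists_lift_of_range_eq κ hκi f₁ hκ.symm
  obtain ⟨g, hg⟩ := f₁.rangeRestrict.exists_rightInverse_of_surjective f₁.range_rangeRestrict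
  refine ⟨ι, κ, LinearMap.snd k _ _ ∘ₗ e.symm.toLinearMap ∘ₗ z,
    LinearMap.fst k _ _ ∘ₗ e.symm.toLinearMap ∘ₗ z, s, w,
    g ∘ₗ κ.codRestrict (LinearMap.range f₁) (fun c => hκ ▸ LinearMap.mem_range_self κ c),
    ?_, ?_, ?_, ?_, ?_, ?_, ?_, ?_⟩
  · refine LinearMap.ext fun c => ?_
    simp [ι, hz]
  · refine LinearMap.ext fun c => ?_
    simp [κ, hz]
  · refine LinearMap.ext fun c => ?_
    simp [ι, hz]
  · refine LinearMap.ext fun c => ?_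
    simp [κ, hz]
  · exact LinearMap.ext fun c => (e (0, c)).2
  · exact LinearMap.ext fun x => (hw x).symm
  · refine LinearMap.ext fun c => ?_
    exact (congrArg Subtype.val (LinearMap.congr_fun hg
      ⟨κ c, hκ ▸ LinearMap.mem_range_self κ c⟩)).symm
  · refine LinearMap.ext fun x => ?_
    change (e (0, (e.symm (z x)).2)).1 + (e ((e.symm (z x)).1, 0)).1 + s (f₀ x) = x
    rw [← Submodule.coe_add, ← map_add, Prod.mk_add_mk, zero_add, add_zero, Prod.mk.eta,
      LinearEquiv.apply_symm_apply]
    exact sub_add_cancel x _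

/-- The homology of a complex of free modules over a domain `R` whose differential is `τ` times one
which is defined over a field `k`: the homology over `k` contributes copies of `R`, and the
boundaries over `k` contribute copies of `T = R / τ`. -/
lemma nonempty_equiv_of_splitting {k R H T : Type*} [Field k] [CommRing R] [IsDomain R] [Algebra k R]
    [AddCommGroup H] [Module R H] [AddCommGroup T] [Module R T] {α₀ α₁ α₂ : Type*} [Finite α₁]
    (f₀ : (α₁ →₀ k) →ₗ[k] (α₀ →₀ k)) (f₁ : (α₂ →₀ k) →ₗ[k] (α₁ →₀ k)) (hf : f₀ ∘ₗ f₁ = 0) (h b : ℕ)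
    (hh : Module.finrank k (LinearMap.ker f₀) = h + b)
    (hb : Module.finrank k (LinearMap.range f₁) = b) (τ : R) (hτ : τ ≠ 0)
    (φ : LinearMap.ker (τ • extend R f₀) →ₗ[R] H) (hφ : Function.Surjective φ)
    (hφ0 : ∀ q, φ q = 0 ↔ ∃ y, (τ • extend R f₁) y = q.1)
    (ψ : R →ₗ[R] T) (hψ : Function.Surjective ψ) (hψ0 : ∀ a, ψ a = 0 ↔ ∃ c, a = τ * c) :
    Nonempty (H ≃ₗ[R] (Fin h → R) × (Fin b → T)) := by
  obtain ⟨ι, κ, p, q, s, w, w', h1, h2, h3, h4, h5, h6, h7, h8⟩ := exists_splitting f₀ f₁ hf h b hh hb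
  have h9 : f₀ ∘ₗ κ = 0 := by rw [h7, ← LinearMap.comp_assoc, hf, LinearMap.zero_comp]
  have e1 := fun x => LinearMap.congr_fun (congrArg (extend R) h1) x
  have e2 := fun x => LinearMap.congr_fun (congrArg (extend R) h2) x
  have e3 := fun x => LinearMap.congr_fun (congrArg (extend R) h3) x
  have e4 := fun x => LinearMap.congr_fun (congrArg (extend R) h4) x
  have e5 := fun x => LinearMap.congr_fun (congrArg (extend R) h5) x
  have e6 := fun x => LinearMap.congr_fun (congrArg (extend R) h6) x
  have e7 := fun x => LinearMap.congr_fun (congrArg (extend R) h7) x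
  have e8 := fun x => LinearMap.congr_fun (congrArg (extend R) h8) x
  have e9 := fun x => LinearMap.congr_fun (congrArg (extend R) h9) x
  simp only [extend_comp, extend_id, extend_zero, extend_add, LinearMap.comp_apply,
    LinearMap.id_apply, LinearMap.zero_apply, LinearMap.add_apply] at e1 e2 e3 e4 e5 e6 e7 e8 e9
  -- Coordinates on the cycles over `R`.
  let θ : ((Fin h →₀ R) × (Fin b →₀ R)) →ₗ[R] LinearMap.ker (τ • extend R f₀) :=
    ((extend R ι).coprod (extend R κ)).codRestrict _ fun x => by
      rw [LinearMap.mem_ker, LinearMap.coprod_apply, LinearMap.smul_apply, map_add, e5, e9,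
        add_zero, smul_zero]
  have hθ : Function.Surjective θ := fun x => by
    refine ⟨(extend R p x.1, extend R q x.1), Subtype.ext ?_⟩
    have hx : τ • extend R f₀ x.1 = 0 := x.2
    have hx' : extend R f₀ x.1 = 0 := (smul_eq_zero.1 hx).resolve_left hτ
    have := e8 x.1
    rwa [hx', map_zero, add_zero] at this
  let μ : ((Fin h →₀ R) × (Fin b →₀ R)) →ₗ[R] ((Fin h → R) × (Fin b → T)) :=
    ((linearEquivFunOnFinite R R (Fin h)).toLinearMap).prodMap
      (ψ.compLeft (Fin b) ∘ₗ (linearEquivFunOnFinite R R (Fin b)).toLinearMap)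
  have hμ : Function.Surjective μ := by
    refine Function.Surjective.prodMap (linearEquivFunOnFinite R R (Fin h)).surjective
      (Function.Surjective.comp (g := ψ.compLeft (Fin b)) (fun t => ?_)
        (linearEquivFunOnFinite R R (Fin b)).surjective)
    choose c hc using fun j => hψ (t j)
    exact ⟨c, funext hc⟩
  have hker : LinearMap.ker (φ ∘ₗ θ) = LinearMap.ker μ := by
    ext ⟨f, g⟩
    have hμ0 : (f, g) ∈ LinearMap.ker μ ↔ f = 0 ∧ ∃ c : Fin b →₀ R, g = τ • c := by
      rw [LinearMap.mem_ker, Prod.ext_iff]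
      refine and_congr (LinearEquiv.map_eq_zero_iff (linearEquivFunOnFinite R R (Fin h)))
        ⟨fun hg => ?_, ?_⟩
      · choose c hc using fun j => (hψ0 (g j)).1 (congrFun hg j)
        exact ⟨(linearEquivFunOnFinite R R (Fin b)).symm c, Finsupp.ext hc⟩
      · rintro ⟨c, rfl⟩
        exact funext fun j => (hψ0 _).2 ⟨c j, rfl⟩
    rw [hμ0, LinearMap.mem_ker, LinearMap.comp_apply, hφ0]
    change (∃ y, τ • extend R f₁ y = extend R ι f + extend R κ g) ↔ _
    constructor
    · rintro ⟨y, hy⟩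
      have hp := congrArg (extend R p) hy
      have hq := congrArg (extend R q) hy
      rw [e6, map_smul, e2, map_add, e1, e2, smul_zero, add_zero] at hp
      rw [e6, map_smul, e4, map_add, e3, e4, zero_add] at hq
      exact ⟨hp.symm, _, hq.symm⟩
    · rintro ⟨rfl, c, rfl⟩
      exact ⟨extend R w' c, by rw [← e7, map_smul, map_zero, zero_add]⟩
  exact ⟨((φ ∘ₗ θ).quotKerEquivOfSurjective (hφ.comp hθ)).symm.trans
    ((Submodule.quotEquivOfEq _ _ hker).trans (μ.quotKerEquivOfSurjective hμ))⟩

end Splitting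

/-! ### The module structure over the group ring of the integers -/

section Decomposition

variable {V : Type u} [LinearOrder V] (Γ : SimpleGraph V) (k : Type u)

/-- If all vertices act by the same scalar `c`, then the Koszul differential is `c` times the simplicial
boundary. -/
lemma koszul_const [CommRing k] {R : Type u} [CommRing R] [Algebra k R] (c : R) (m : ℕ) :
    koszul Γ (fun _ => c) m = c • extend R (boundary Γ k m) := by
  refine Finsupp.lhom_ext' fun s => LinearMap.ext_ring ?_
  simp only [LinearMap.comp_apply, lsingle_apply, LinearMap.smul_apply, koszul_single, extend,
    linearCombination_single, boundary, one_smul, map_sum, Finset.smul_sum, inclCoeff_single]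
  refine Finset.sum_congr rfl fun v _ => ?_
  rw [smul_single, map_pow, map_neg, map_one, one_mul, smul_eq_mul, mul_comm]

lemma flagComplex_d [CommRing k] (m : ℕ) :
    (flagComplex Γ k).d (m + 1) m = ModuleCat.ofHom (boundary Γ k m) := by
  simp [flagComplex]

/-- The space of cycles is the sum of the reduced homology and the boundaries. -/
lemma finrank_ker_boundary [Field k] [Finite V] (r : ℕ) :
    Module.finrank k (LinearMap.ker (boundary Γ k r)) =
      Module.finrank k (reducedHomology Γ k r) + Module.finrank k (boundaries Γ k r) := by
  let S : ShortComplex (ModuleCat k) := ShortComplex.mk (ModuleCat.ofHom (boundary Γ k (r + 1)))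
    (ModuleCat.ofHom (boundary Γ k r)) (ModuleCat.hom_ext (boundary_comp_boundary Γ k r))
  let e : (flagComplex Γ k).sc' (r + 2) (r + 1) r ≅ S :=
    ShortComplex.isoMk (Iso.refl _) (Iso.refl _) (Iso.refl _)
      (by
        refine (Category.id_comp _).trans (Eq.trans ?_ (Category.comp_id _).symm)
        exact (flagComplex_d Γ k (r + 1)).symm)
      (by
        refine (Category.id_comp _).trans (Eq.trans ?_ (Category.comp_id _).symm)
        exact (flagComplex_d Γ k r).symm)
  let i : reducedHomology Γ k r ≅ S.moduleCatLeftHomologyData.H :=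
    (flagComplex Γ k).homologyIsoSc' (r + 2) (r + 1) r (by simp) (by simp) ≪≫
      ShortComplex.homologyMapIso e ≪≫ S.moduleCatHomologyIso
  rw [i.toLinearEquiv.finrank_eq]
  have h1 : (LinearMap.range S.moduleCatToCycles).map
      (LinearMap.ker (boundary Γ k r)).subtype = boundaries Γ k r := by
    rw [← LinearMap.range_comp]
    rfl
  rw [← h1]
  refine Eq.trans ?_ (congrArg _ (Submodule.finrank_map_subtype_eq _ _).symm)
  exact (Submodule.finrank_quotient_add_finrank (LinearMap.range S.moduleCatToCycles)).symm

/-- The augmentation ideal of `k[ℤ]` is generated by `t - 1`. -/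
lemma exists_eq_mul_tSubOne [CommRing k] (a : MonoidAlgebra k (Multiplicative ℤ)) :
    augmentation k _ a = 0 ↔ ∃ c, a = tSubOne k * c := by
  constructor
  · intro ha
    have hJ : ∀ z, MonoidAlgebra.of k (Multiplicative ℤ) z - 1 ∈ Ideal.span {tSubOne k} := by
      intro z
      have hn : ∀ n : ℕ, MonoidAlgebra.of k (Multiplicative ℤ) (Multiplicative.ofAdd (n : ℤ)) - 1 ∈
          Ideal.span {tSubOne k} := by
        intro n
        have : MonoidAlgebra.of k (Multiplicative ℤ) (Multiplicative.ofAdd (n : ℤ)) =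
            MonoidAlgebra.of k (Multiplicative ℤ) (Multiplicative.ofAdd 1) ^ n := by
          rw [← map_pow, ← ofAdd_nsmul]
          simp
        rw [this, Ideal.mem_span_singleton]
        exact sub_one_dvd_pow_sub_one _ _
      obtain ⟨n, hz | hz⟩ := z.toAdd.eq_nat_or_neg
      · have := hn n
        rwa [← hz] at this
      · have h2 := Ideal.mul_mem_left _ (-MonoidAlgebra.of k _ z) (hn n)
        have h3 : z * Multiplicative.ofAdd (n : ℤ) = 1 := by
          rw [← ofAdd_toAdd z, hz, ← ofAdd_add, neg_add_cancel, ofAdd_zero]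
        rwa [mul_sub, neg_mul, ← map_mul, h3, map_one, mul_one, sub_neg_eq_add, neg_add_eq_sub] at h2
    have h := sub_augmentation_mem k (Ideal.span {tSubOne k}) hJ a
    rwa [ha, map_zero, sub_zero, Ideal.mem_span_singleton] at h
  · rintro ⟨c, rfl⟩
    rw [map_mul, tSubOne, map_sub, augmentation_of, map_one, sub_self, zero_mul]

lemma tSubOne_ne_zero [Field k] : tSubOne k ≠ 0 := by
  intro h
  have h1 := sub_eq_zero.1 h
  have := MonoidAlgebra.of_injective (R := k) (h1.trans (map_one _).symm)
  exact one_ne_zero (α := ℤ) (congrArg Multiplicative.toAdd this)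

/-- The augmentation as a map onto the trivial module. -/
noncomputable def toTrivial [Field k] : MonoidAlgebra k (Multiplicative ℤ)
    →ₗ[MonoidAlgebra k (Multiplicative ℤ)] (Representation.trivial k (Multiplicative ℤ) k).asModule :=
  MonoidAlgebra.equivariantOfLinearOfComm
    ((Representation.trivial k (Multiplicative ℤ) k).asModuleEquiv.symm.toLinearMap ∘ₗ
      (augmentation k (Multiplicative ℤ)).toLinearMap) fun g v => by
    rw [Representation.single_smul, one_smul]
    change augmentation k _ (MonoidAlgebra.of k _ g * v) = augmentation k _ v
    rw [map_mul, augmentation_of, one_mul]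

end Decomposition

end BestvinaBrady

theorem proposition7p1 {V : Type u} [Finite V] [Nonempty V] [LinearOrder V] (Γ : SimpleGraph V)
    (k : Type u) [Field k] (r : ℕ) (hr : 0 < r) :
    Nonempty ((BestvinaBrady.homologyRep Γ k r).asModule ≃ₗ[MonoidAlgebra k (Multiplicative ℤ)]
      (Fin (Module.finrank k (BestvinaBrady.reducedHomology Γ k (r - 1))) →
          MonoidAlgebra k (Multiplicative ℤ)) ×
        (Fin (Module.finrank k (BestvinaBrady.boundaries Γ k (r - 1))) →
          (Representation.trivial k (Multiplicative ℤ) k).asModule)) := by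
  obtain ⟨r, rfl⟩ := Nat.exists_eq_succ_of_ne_zero hr.ne'
  obtain ⟨φ, hφ, hφ0⟩ := BestvinaBrady.exists_map_homologyRep Γ k r
  rw [BestvinaBrady.koszul_const Γ k (BestvinaBrady.tSubOne k) (r + 1)] at hφ0
  revert φ
  rw [BestvinaBrady.koszul_const Γ k (BestvinaBrady.tSubOne k) r]
  intro φ hφ hφ0
  refine BestvinaBrady.nonempty_equiv_of_splitting (BestvinaBrady.boundary Γ k r)
    (BestvinaBrady.boundary Γ k (r + 1)) (BestvinaBrady.boundary_comp_boundary Γ k r) _ _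
    (BestvinaBrady.finrank_ker_boundary Γ k r) rfl (BestvinaBrady.tSubOne k)
    (BestvinaBrady.tSubOne_ne_zero k) φ hφ hφ0 (BestvinaBrady.toTrivial k) (fun c => ?_) fun a => ?_
  · exact ⟨algebraMap k _ c, (BestvinaBrady.augmentation k _).commutes c⟩
  · exact BestvinaBrady.exists_eq_mul_tSubOne k a
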